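/- Let $\mathcal A(I)$ be one of the following algebras of ordinary differential operators $\alpha_m D^m+\dots+\alpha_1D+\alpha_0$, whose coefficients $\alpha_i$ are functions on $I$ and which act on the space of all coefficient functions: 1. $I\subseteq\mathbb R$ is a non-empty open interval, the coefficient functions are the real-valued smooth functions on $I$, and $D=d/dt$; put $\mathbb K=\mathbb R$. 2. $I\subset\mathbb C$ is a non-compact, simply connected real one-dimensional smooth (embedded) submanifold, the coefficient functions are the complex-valued smooth functions on $I$, and $D=d/dz$ is the derivative along $I$ with respect to $z\in I$; put $\mathbb K=\mathbb C$. 3. $I\subseteq\mathbb C$ is non-empty, open and connected, the coefficient functions are the holomorphic functions on $I$, and $D=d/dz$; put $\mathbb K=\mathbb C$. The order of an operator is the largest $m$ such that $\alpha_m$ does not vanish identically; $\alpha_m$ is then the highest coefficient. **Theorem.** Let $P,Q\in\mathcal A(I)$ be commuting operators of orders $m$ and $n$, not both zero. In cases 1 and 2 assume moreover that at least one of $P$, $Q$ has positive order and a highest coefficient without zeros on $I$ (for instance a constant one). Let $d=\gcd(m,n)$. Then there is a polynomial $f(\lambda,\mu)\in\mathbb K[\lambda,\mu]$ with constant coefficients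 such that (i) if $\lambda$ is given the weight $m$ and $\mu$ the weight $n$, then the weighted degree of $f$ is equal to $mn$, and the part of $f$ of weighted degree $mn$ is $$\bigl(\mu^{m/d}+c\,\lambda^{n/d}\bigr)^{d}$$ with a constant $c\in\mathbb K$, $c\neq0$; in particular it is $\mu^m+c\lambda^n$ if $m$ and $n$ are coprime; (ii) the differential operator $f(P,Q)$ is identically zero. -/

import Mathlib

open Filter
open scoped ContDiff Topology

noncomputable section

namespace BurchnallChaundy

theorem extend_apply {𝕜 : Type*} [Zero 𝕜] {I : Set 𝕜} (u : I → 𝕜) {x : 𝕜} (hx : x ∈ I) :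
    Function.extend Subtype.val u (0 : 𝕜 → 𝕜) x = u ⟨x, hx⟩ :=
  Subtype.val_injective.extend_apply u 0 ⟨x, hx⟩

/-- The algebra of `𝕜`-valued functions on `I ⊆ 𝕜` which are infinitely often differentiable
with respect to the variable `z ∈ I`, all difference quotients being taken along `I`.
For `I ⊆ ℝ` open this is `C^∞(I, ℝ)`, for `I ⊆ ℂ` open it is the algebra of holomorphic functions,
and for a smooth curve `I ⊆ ℂ` it is `C^∞(I, ℂ)`; see `contDiffOn_complex_iff_real` for the last
one. (The value `0` outside of `I` is irrelevant, as only values on `I` are used.) -/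
def smoothFunctions (𝕜 : Type*) [RCLike 𝕜] (I : Set 𝕜) : Subalgebra 𝕜 (I → 𝕜) where
  carrier := {f | ContDiffOn 𝕜 ∞ (Function.extend Subtype.val f 0) I}
  mul_mem' := by
    intro f g hf hg
    refine (ContDiffOn.mul hf hg).congr fun x hx => ?_
    simp only [extend_apply _ hx, Pi.mul_apply]
  add_mem' := by
    intro f g hf hg
    refine (ContDiffOn.add hf hg).congr fun x hx => ?_
    simp only [extend_apply _ hx, Pi.add_apply]
  algebraMap_mem' := by
    intro r
    refine (contDiffOn_const (c := r)).congr fun x hx => ?_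
    rw [extend_apply _ hx]
    rfl

/-- The operator `D = d/dz` on functions on `I`:
`(D f)(z)` is the limit of `(f w - f z) / (w - z)` for `w → z`, `w ∈ I \ {z}`. -/
def D (𝕜 : Type*) [RCLike 𝕜] (I : Set 𝕜) (hI : UniqueDiffOn 𝕜 I) :
    Module.End 𝕜 (smoothFunctions 𝕜 I) where
  toFun f := ⟨fun z => derivWithin (Function.extend Subtype.val f.1 0) I z, by
    have hf : ContDiffOn 𝕜 ∞ (Function.extend Subtype.val f.1 0) I := f.2
    refine (hf.derivWithin hI (m := ∞) (by simp)).congr fun x hx => ?_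
    rw [extend_apply _ hx]⟩
  map_add' f g := by
    ext ⟨x, hx⟩
    have hf : ContDiffOn 𝕜 ∞ (Function.extend Subtype.val f.1 0) I := f.2
    have hg : ContDiffOn 𝕜 ∞ (Function.extend Subtype.val g.1 0) I := g.2
    have hf' := (hf.differentiableOn (by simp) x hx).hasDerivWithinAt
    have hg' := (hg.differentiableOn (by simp) x hx).hasDerivWithinAt
    refine ((hf'.add hg').congr (fun y hy => ?_) ?_).derivWithin (hI x hx)
    · simp [extend_apply _ hy]
    · simp [extend_apply _ hx]
  map_smul' c f := by
    ext ⟨x, hx⟩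
    have hf : ContDiffOn 𝕜 ∞ (Function.extend Subtype.val f.1 0) I := f.2
    have hf' := (hf.differentiableOn (by simp) x hx).hasDerivWithinAt
    refine ((hf'.const_mul c).congr (fun y hy => ?_) ?_).derivWithin (hI x hx)
    · simp [extend_apply _ hy]
    · simp [extend_apply _ hx]

/-- The ordinary differential operator `α_m D^m + ⋯ + α_1 D + α_0`, as an endomorphism of the
space of coefficient functions. It has order `m` if `α_m`, that is `α (Fin.last m)`, is not
identically zero. -/
def diffOp {𝕜 : Type*} [RCLike 𝕜] {I : Set 𝕜} (hI : UniqueDiffOn 𝕜 I) {m : ℕ}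
    (α : Fin (m + 1) → smoothFunctions 𝕜 I) : Module.End 𝕜 (smoothFunctions 𝕜 I) :=
  ∑ i, α i • D 𝕜 I hI ^ (i : ℕ)

/-- `I ⊆ ℂ` is a real one-dimensional smooth (embedded) submanifold of `ℂ = ℝ²`: around each of its
points there is a smooth chart of the plane in which `I` becomes a part of the real axis. -/
def IsSmoothCurve (I : Set ℂ) : Prop :=
  ∀ z ∈ I, ∃ Φ : OpenPartialHomeomorph ℂ ℂ, z ∈ Φ.source ∧
    ContDiffOn ℝ ∞ Φ Φ.source ∧ ContDiffOn ℝ ∞ Φ.symm Φ.target ∧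
    ∀ w ∈ Φ.source, w ∈ I ↔ (Φ w).im = 0

theorem IsSmoothCurve.uniqueDiffOn {I : Set ℂ} (h : IsSmoothCurve I) : UniqueDiffOn ℂ I := by
  intro z hz
  obtain ⟨Φ, hzΦ, -, -, hI⟩ := h z hz
  rw [uniqueDiffWithinAt_iff_accPt, accPt_principal_iff_nhdsWithin]
  have him : (Φ z).im = 0 := (hI z hzΦ).1 hz
  have hγ0 : Φ.symm (Φ z + ((0 : ℝ) : ℂ)) = z := by simp [hzΦ]
  have hc : ContinuousAt (fun s : ℝ => Φ z + (s : ℂ)) 0 := by fun_prop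
  have hmem : ∀ᶠ s : ℝ in 𝓝 0, Φ z + (s : ℂ) ∈ Φ.target :=
    hc (Φ.open_target.mem_nhds (by simpa using Φ.map_source hzΦ))
  have hcont : ContinuousAt (fun s : ℝ => Φ.symm (Φ z + (s : ℂ))) 0 :=
    ContinuousAt.comp (f := fun s : ℝ => Φ z + (s : ℂ)) (g := Φ.symm)
      (Φ.continuousAt_symm (by simpa using Φ.map_source hzΦ)) hc
  have ht : Tendsto (fun s : ℝ => Φ.symm (Φ z + (s : ℂ))) (𝓝[≠] 0) (𝓝[I \ {z}] z) := by
    refine tendsto_nhdsWithin_iff.2 ⟨?_, ?_⟩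
    · have := hcont.tendsto.mono_left (nhdsWithin_le_nhds (s := {0}ᶜ))
      rwa [hγ0] at this
    · filter_upwards [nhdsWithin_le_nhds hmem, self_mem_nhdsWithin] with s hs hs0
      refine ⟨(hI _ (Φ.map_target hs)).2 (by simp [Φ.right_inv hs, him]), fun he => hs0 ?_⟩
      have := Φ.right_inv hs
      rw [he] at this
      simpa using this
  exact ht.neBot

/-- A smooth function on a smooth curve in the plane is differentiable along the curve with respect
to the complex variable, with a smooth derivative. -/
theorem IsSmoothCurve.derivWithin_aux {I : Set ℂ} (h : IsSmoothCurve I) {f : ℂ → ℂ}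
    (hf : ContDiffOn ℝ ∞ f I) :
    DifferentiableOn ℂ f I ∧ ContDiffOn ℝ ∞ (derivWithin f I) I := by
  suffices key : ∀ z ∈ I, ∃ u, IsOpen u ∧ z ∈ u ∧ ∃ g : ℂ → ℂ, ContDiffOn ℝ ∞ g (I ∩ u) ∧
      ∀ w ∈ I ∩ u, HasDerivWithinAt f (g w) I w by
    constructor
    · intro z hz
      obtain ⟨u, -, hzu, g, -, hg⟩ := key z hz
      exact (hg z ⟨hz, hzu⟩).differentiableWithinAt
    · refine contDiffOn_of_locally_contDiffOn fun z hz => ?_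
      obtain ⟨u, hu, hzu, g, hgs, hg⟩ := key z hz
      exact ⟨u, hu, hzu, hgs.congr fun w hw => (hg w hw).derivWithin (h.uniqueDiffOn w hw.1)⟩
  intro z hz
  obtain ⟨Φ, hzΦ, hΦ, hΨ, hI⟩ := h z hz
  let S : Set ℝ := {s | (s : ℂ) ∈ Φ.target}
  have hS : IsOpen S := Φ.open_target.preimage Complex.continuous_ofReal
  let γ : ℝ → ℂ := fun s => Φ.symm s
  have hγI : Set.MapsTo γ S I := fun s hs =>
    (hI _ (Φ.map_target hs)).2 (by simp [Φ.right_inv hs])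
  have hofReal : ContDiff ℝ ∞ (fun s : ℝ => (s : ℂ)) := Complex.ofRealCLM.contDiff
  have hγ : ContDiffOn ℝ ∞ γ S := hΨ.comp hofReal.contDiffOn fun s hs => hs
  have hfγ : ContDiffOn ℝ ∞ (f ∘ γ) S := hf.comp hγ hγI
  let ρ : ℂ → ℝ := fun w => (Φ w).re
  have hρ : ContDiffOn ℝ ∞ ρ Φ.source := Complex.reCLM.contDiff.comp_contDiffOn hΦ
  have hre : ∀ w ∈ I ∩ Φ.source, ((ρ w : ℝ) : ℂ) = Φ w := fun w hw =>
    Complex.ext (by simp [ρ]) (by simp [(hI w hw.2).1 hw.1])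
  have hρS : Set.MapsTo ρ (I ∩ Φ.source) S := fun w hw => by
    change ((ρ w : ℝ) : ℂ) ∈ Φ.target
    rw [hre w hw]
    exact Φ.map_source hw.2
  have hγρ : ∀ w ∈ I ∩ Φ.source, γ (ρ w) = w := fun w hw => by
    change Φ.symm ((ρ w : ℝ) : ℂ) = w
    rw [hre w hw, Φ.left_inv hw.2]
  have hdγ : ∀ s ∈ S, HasDerivAt γ (deriv γ s) s := fun s hs =>
    ((hγ.differentiableOn (by simp)).differentiableAt (hS.mem_nhds hs)).hasDerivAt
  have hdfγ : ∀ s ∈ S, HasDerivAt (f ∘ γ) (deriv (f ∘ γ) s) s := fun s hs =>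
    ((hfγ.differentiableOn (by simp)).differentiableAt (hS.mem_nhds hs)).hasDerivAt
  have hγ0 : ∀ s ∈ S, deriv γ s ≠ 0 := by
    intro s hs h0
    have h1 := hdγ s hs
    rw [h0] at h1
    have h2 : HasFDerivAt ρ (fderiv ℝ ρ (γ s)) (γ s) :=
      ((hρ.differentiableOn (by simp)).differentiableAt
        (Φ.open_source.mem_nhds (Φ.map_target hs))).hasFDerivAt
    have h3 : HasDerivAt (ρ ∘ γ) 0 s := by simpa using h2.comp_hasDerivAt s h1
    have h4 : HasDerivAt (ρ ∘ γ) 1 s := by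
      refine (hasDerivAt_id s).congr_of_eventuallyEq ?_
      filter_upwards [hS.mem_nhds hs] with t ht
      change (Φ (Φ.symm (t : ℂ))).re = t
      rw [Φ.right_inv ht, Complex.ofReal_re]
    exact zero_ne_one (h3.unique h4)
  refine ⟨Φ.source, Φ.open_source, hzΦ, fun w => deriv (f ∘ γ) (ρ w) / deriv γ (ρ w), ?_, ?_⟩
  · have hρ' := hρ.mono (Set.inter_subset_right (s := I))
    have e : (∞ : WithTop ℕ∞) + 1 ≤ ∞ := by simp
    have h1 := (hfγ.deriv_of_isOpen hS e).comp hρ' hρS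
    have h2 := ((hγ.deriv_of_isOpen hS e).comp hρ' hρS).inv fun w hw => hγ0 _ (hρS hw)
    exact (h1.mul h2).congr fun w hw => by simp [div_eq_mul_inv]
  · intro w hw
    have hρw : HasFDerivWithinAt ρ (fderiv ℝ ρ w) I w :=
      (((hρ.differentiableOn (by simp)).differentiableAt
        (Φ.open_source.mem_nhds hw.2)).hasFDerivAt).hasFDerivWithinAt
    have hev : ∀ᶠ x in 𝓝[I] w, x ∈ I ∩ Φ.source := by
      filter_upwards [self_mem_nhdsWithin, nhdsWithin_le_nhds (Φ.open_source.mem_nhds hw.2)]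
        with x h1 h2 using ⟨h1, h2⟩
    obtain ⟨s, hs⟩ : ∃ s, s = ρ w := ⟨_, rfl⟩
    have hsS : s ∈ S := hs ▸ hρS hw
    simp only [← hs]
    have hchain (u : ℝ → ℂ) (hu : HasDerivAt u (deriv u s) s) :
        HasFDerivWithinAt (u ∘ ρ) ((fderiv ℝ ρ w).smulRight (deriv u s)) I w := by
      rw [hs] at hu ⊢
      refine (hu.hasFDerivAt.comp_hasFDerivWithinAt w hρw).congr_fderiv ?_
      ext x; simp
    have h1 : HasFDerivWithinAt f ((fderiv ℝ ρ w).smulRight (deriv (f ∘ γ) s)) I w := by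
      refine (hchain (f ∘ γ) (hdfγ s hsS)).congr_of_eventuallyEq ?_ ?_
      · filter_upwards [hev] with x hx
        simp only [Function.comp_apply, hγρ x hx]
      · simp only [Function.comp_apply, hγρ w hw]
    have h2 : HasFDerivWithinAt id ((fderiv ℝ ρ w).smulRight (deriv γ s)) I w := by
      refine (hchain γ (hdγ s hsS)).congr_of_eventuallyEq ?_ ?_
      · filter_upwards [hev] with x hx
        simp only [Function.comp_apply, hγρ x hx, id]
      · simp only [Function.comp_apply, hγρ w hw, id]
    have hne := hγ0 s hsS
    rw [hasDerivWithinAt_iff_isLittleO]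
    rw [hasFDerivWithinAt_iff_isLittleO] at h1 h2
    refine (h1.sub (h2.const_mul_left (deriv (f ∘ γ) s / deriv γ s))).congr_left fun x => ?_
    simp only [ContinuousLinearMap.smulRight_apply, Complex.real_smul, smul_eq_mul, id]
    field_simp
    ring

/-- On a smooth curve, being infinitely often differentiable with respect to `z` along the curve
is the same as being smooth in the real sense. -/
theorem contDiffOn_complex_iff_real {I : Set ℂ} (h : IsSmoothCurve I) {f : ℂ → ℂ} :
    ContDiffOn ℂ ∞ f I ↔ ContDiffOn ℝ ∞ f I := by
  refine ⟨fun hf => hf.restrict_scalars ℝ, fun hf => contDiffOn_infty.2 fun n => ?_⟩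
  induction n generalizing f with
  | zero => simpa using hf.continuousOn
  | succ n ih =>
    obtain ⟨h1, h2⟩ := h.derivWithin_aux hf
    push_cast
    exact (contDiffOn_succ_iff_derivWithin h.uniqueDiffOn).2 ⟨h1, by simp, ih h2⟩

/-- `f(P, Q)` for a polynomial `f = ∑ f_{ij} λ^i μ^j`, namely `∑ f_{ij} P^i Q^j`. The variables are
`λ = X 0` and `μ = X 1`. The order of the factors is immaterial if `P` and `Q` commute. -/
def evalPair {𝕜 A : Type*} [Field 𝕜] [Ring A] [Algebra 𝕜 A] (f : MvPolynomial (Fin 2) 𝕜)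
    (P Q : A) : A :=
  ∑ e ∈ f.support, f.coeff e • (P ^ e 0 * Q ^ e 1)

/-- There is a polynomial `f(λ, μ)` with constant coefficients such that `f(P, Q) = 0`, whose
weighted degree (`λ` of weight `m` and `μ` of weight `n`) is `m n`, and whose part of weighted
degree `m n` is `(μ ^ (m / d) + c λ ^ (n / d)) ^ d` with `d = gcd(m, n)` and `c ≠ 0`; this is
`μ ^ m + c λ ^ n` for coprime `m` and `n`. -/
def HasRelation (𝕜 : Type*) {A : Type*} [Field 𝕜] [Ring A] [Algebra 𝕜 A] (m n : ℕ) (P Q : A) : Prop :=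
  ∃ (f : MvPolynomial (Fin 2) 𝕜) (c : 𝕜), c ≠ 0 ∧
    f.weightedTotalDegree ![m, n] = m * n ∧
    MvPolynomial.weightedHomogeneousComponent ![m, n] (m * n) f =
      (MvPolynomial.X 1 ^ (m / m.gcd n) +
        MvPolynomial.C c * MvPolynomial.X 0 ^ (n / m.gcd n)) ^ m.gcd n ∧
    (m.Coprime n → MvPolynomial.weightedHomogeneousComponent ![m, n] (m * n) f =
      MvPolynomial.X 1 ^ m + MvPolynomial.C c * MvPolynomial.X 0 ^ n) ∧
    evalPair f P Q = 0

end BurchnallChaundy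

end

open BurchnallChaundy

/-! Write `A` for the ring of coefficient functions and let λ act on differential operators by right
multiplication by `P`. If the highest coefficient of `P` is a unit, division by powers of `P` shows
that the operators form a free `A[λ]`-module with basis `1, D, …, D^(m-1)` (`exists_combo`,
`combo_injective`). As `Q` commutes with `P`, right multiplication by `Q` is `A[λ]`-linear and has a
matrix `B` over `A[λ]`. Cayley–Hamilton, applied to the element `1`, gives a relation between `P`
and `Q` with coefficients in `A` (`sum_charpoly_eq_zero`).

These coefficients are constants. Left multiplication by `D` is a connection on the module and
commutes with right multiplication by `Q`; if `Γ` is its matrix, then `B' = Γ B - B Γ`. Such a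
deformation is isospectral, so the characteristic polynomial has derivative zero
(`charpoly_coeff_constant`).

For the leading part, `D^i Q` has order `n + i`, so the entry `B i j` has weight at most `n + i -
j`. At a point where the highest coefficients of `P` and `Q` take nonzero values `a` and `b`, the
top parts of `B` describe multiplication by `b ξ^n` on `K[ξ]/(a ξ^m - 1)`. The `(m/d)`-th power of
this map is the scalar `u = b^(m/d) a^(-n/d)`, which forces its characteristic polynomial to be
`(μ^(m/d) - u)^d` and gives `c = -u` (`charpoly_weights`).

If only `Q` has a highest coefficient without zeros, the roles are exchanged (`HasRelation.symm`).
Holomorphic operators are restricted to a ball on which the highest coefficient has no zeros, and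
the identity theorem carries the relation back. -/

noncomputable section

namespace BurchnallChaundy

/-! ### Determinants and characteristic polynomials -/

section

open Polynomial

/-- A derivation of `S`, in the form of a ring homomorphism into the dual numbers, annihilates the
coefficients of the characteristic polynomial of a matrix whose derivative is a commutator. -/
theorem snd_charpoly_coeff_eq_zero {S ι : Type*} [CommRing S] [Fintype ι] [DecidableEq ι]
    (τ : S →+* DualNumber S) (hτ : ∀ s, (τ s).fst = s) (M Γ : Matrix ι ι S)
    (hM : ∀ i j, (τ (M i j)).snd = (Γ * M - M * Γ) i j) (k : ℕ) :
    (τ (M.charpoly.coeff k)).snd = 0 := by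
  let inl : S →+* DualNumber S := TrivSqZeroExt.inlHom S S
  let ε : DualNumber S := DualNumber.eps
  have hε : ε * ε = 0 := DualNumber.eps_mul_eps
  let G : Matrix ι ι (DualNumber S) := inl.mapMatrix Γ
  let N : Matrix ι ι (DualNumber S) := inl.mapMatrix M
  have h1 : (1 + ε • G) * (1 - ε • G) = 1 := by
    simp [mul_sub, add_mul, smul_smul, hε]
  have h2 : (1 - ε • G) * (1 + ε • G) = 1 := by
    simp [mul_add, sub_mul, smul_smul, hε]
  let U : (Matrix ι ι (DualNumber S))ˣ := ⟨1 + ε • G, 1 - ε • G, h1, h2⟩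
  -- Conjugation by `1 + ε Γ` adds `ε (Γ M - M Γ)` to `M`, which is the ε-part of `τ M`. Hence `τ M`
  -- and the constant lift of `M` have the same characteristic polynomial.
  have hconj : τ.mapMatrix M = U.val * N * U⁻¹.val := by
    have : U.val * N * U⁻¹.val = N + ε • inl.mapMatrix (Γ * M - M * Γ) := by
      change (1 + ε • G) * N * (1 - ε • G) = _
      simp only [map_sub, map_mul]
      change _ = N + ε • (G * N - N * G)
      simp only [add_mul, mul_sub, one_mul, mul_one, smul_mul_assoc, mul_smul_comm, smul_add,
        smul_sub, mul_assoc]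
      simp only [smul_smul, hε, zero_smul]
      abel
    rw [this]
    ext i j
    · simp [hτ, N, inl, ε]
    · simp only [RingHom.mapMatrix_apply, Matrix.map_apply, hM, Matrix.add_apply, Matrix.smul_apply,
        smul_eq_mul, N, inl, ε]
      simp
  have h3 : (τ.mapMatrix M).charpoly = N.charpoly := by
    rw [hconj, Matrix.coe_units_inv, Matrix.charpoly_units_conj]
  have h4 : (M.charpoly.map τ).coeff k = (M.charpoly.map inl).coeff k := by
    rw [← Matrix.charpoly_map, ← Matrix.charpoly_map]
    exact congrArg (fun p => p.coeff k) h3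
  rw [coeff_map, coeff_map] at h4
  rw [h4]
  simp [inl]

theorem det_coeff_card_mul {S ι : Type*} [CommRing S] [Fintype ι] [DecidableEq ι]
    (M : Matrix ι ι S[X]) (d : ℕ) (hM : ∀ i j, (M i j).natDegree ≤ d) :
    M.det.natDegree ≤ Fintype.card ι * d ∧
      M.det.coeff (Fintype.card ι * d) = (Matrix.of fun i j => (M i j).coeff d).det := by
  rw [Matrix.det_apply, Matrix.det_apply]
  constructor
  · refine natDegree_sum_le_of_forall_le _ _ fun σ _ => (natDegree_smul_le _ _).trans ?_
    refine (natDegree_prod_le _ _).trans ?_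
    exact (Finset.sum_le_card_nsmul _ _ d fun i _ => hM _ _).trans (by simp)
  · rw [finsetSum_coeff]
    refine Finset.sum_congr rfl fun σ _ => ?_
    rw [coeff_smul]
    congr 1
    exact coeff_prod_of_natDegree_le (s := Finset.univ) _ _ (fun p _ => hM _ _)

/-- Degree and leading coefficient of a determinant whose `(i, j)` entry has degree at most
`n + i - j`. -/
theorem det_coeff_mul_of_shifted {S : Type*} [CommRing S] {m : ℕ} (n : ℕ)
    (M : Matrix (Fin m) (Fin m) S[X])
    (hM : ∀ (i j : Fin m) (k : ℕ), n + (i : ℕ) < k + j → (M i j).coeff k = 0) :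
    (∀ k, m * n < k → M.det.coeff k = 0) ∧
      M.det.coeff (m * n) = (Matrix.of fun i j : Fin m =>
        if (j : ℕ) ≤ n + i then (M i j).coeff (n + i - j) else 0).det := by
  -- Scaling row `i` by `X^(m-i)` and column `j` by `X^j` bounds all entries uniformly by degree `m
  -- + n`, at the cost of a factor `X^(m*m)` in the determinant.
  let N : Matrix (Fin m) (Fin m) S[X] :=
    Matrix.of fun i j => X ^ (m - (i : ℕ)) * (X ^ (j : ℕ) * M i j)
  have hN : ∀ (i j : Fin m) (k : ℕ), (N i j).coeff k =
      if m + j ≤ k + i then (M i j).coeff (k + i - (m + j)) else 0 := by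
    intro i j k
    have : N i j = X ^ (m - (i : ℕ) + j) * M i j := by
      simp only [N, Matrix.of_apply]; ring
    rw [this, coeff_X_pow_mul']
    have := i.2
    split_ifs with h1 h2 h2
    · congr 1; omega
    · omega
    · omega
    · rfl
  have hdet : N.det = X ^ (m * m) * M.det := by
    have h := Matrix.det_mul_column (fun i : Fin m => (X : S[X]) ^ (m - (i : ℕ)))
      (Matrix.of fun i j => X ^ (j : ℕ) * M i j)
    have h' := Matrix.det_mul_row (fun j : Fin m => (X : S[X]) ^ (j : ℕ)) M
    have hsum : ∑ i : Fin m, (m - (i : ℕ)) + ∑ i : Fin m, (i : ℕ) = m * m := by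
      rw [← Finset.sum_add_distrib, Finset.sum_congr rfl (g := fun _ => m)]
      · simp
      · intro i _
        have := i.2
        omega
    rw [h'] at h
    rw [← hsum, pow_add, ← Finset.prod_pow_eq_pow_sum, ← Finset.prod_pow_eq_pow_sum, mul_assoc]
    exact h
  obtain ⟨h1, h2⟩ := det_coeff_card_mul N (m + n) (fun i j => by
    refine natDegree_le_iff_coeff_eq_zero.2 fun k hk => ?_
    rw [hN]
    split_ifs with h
    · exact hM i j _ (by omega)
    · rfl)
  rw [hdet, Fintype.card_fin] at h1 h2
  constructor
  · intro k hk
    have h3 : (X ^ (m * m) * M.det).coeff (k + m * m) = 0 :=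
      coeff_eq_zero_of_natDegree_lt (h1.trans_lt (by rw [mul_add]; omega))
    rwa [coeff_X_pow_mul] at h3
  · rw [mul_add, add_comm (m * m), coeff_X_pow_mul] at h2
    rw [h2]
    congr 1
    ext i j
    simp only [Matrix.of_apply, hN]
    split_ifs with h3 h4 h4
    · congr 1; omega
    · omega
    · omega
    · rfl

/-- The matrix `X - T` divides `X^k - T^k`, which is the scalar matrix `X^k - u`; take determinants.
-/
theorem charpoly_dvd_of_pow_eq {K ι : Type*} [CommRing K] [Fintype ι] [DecidableEq ι]
    (T : Matrix ι ι K) (k : ℕ) (u : K) (h : T ^ k = Matrix.scalar ι u) :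
    T.charpoly ∣ (X ^ k - C u) ^ Fintype.card ι := by
  have hc : Commute (Matrix.scalar ι (X : K[X])) (C.mapMatrix T) :=
    Matrix.scalar_commute _ (fun _ => Commute.all _ _) _
  obtain ⟨G, hG⟩ := hc.sub_dvd_pow_sub_pow k
  have h2 : Matrix.scalar ι (X : K[X]) ^ k - (C.mapMatrix T) ^ k =
      Matrix.scalar ι (X ^ k - C u : K[X]) := by
    rw [← map_pow, ← map_pow, h, map_sub]
    congr 1
    ext i j : 2
    simp [Matrix.diagonal_apply, apply_ite]
  rw [h2] at hG
  have h3 := congrArg Matrix.det hG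
  rw [Matrix.det_mul] at h3
  refine ⟨G.det, ?_⟩
  rw [Matrix.charpoly, Matrix.charmatrix]
  rw [← h3, Matrix.scalar_apply, Matrix.det_diagonal]
  simp

/-- A monic polynomial in `X ^ k` all of whose roots satisfy `X ^ k = u` is a power of
`X ^ k - u`. -/
theorem eq_pow_of_dvd_pow {K : Type*} [Field K] {k d : ℕ} (hk : 0 < k) {u : K} {g : K[X]}
    (hg : g.Monic) (hd : g.natDegree = k * d) (hgk : ∀ j, g.coeff j ≠ 0 → k ∣ j) {N : ℕ}
    (hdvd : g ∣ (X ^ k - C u) ^ N) : g = (X ^ k - C u) ^ d := by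
  let h : K[X] := contract k g
  have hgh : g = expand K k h := by
    ext j
    rw [coeff_expand hk, coeff_contract hk.ne']
    split_ifs with hj
    · rw [Nat.div_mul_cancel hj]
    · by_contra h0
      exact hj (hgk j h0)
  have hhd : h.natDegree = d := by
    have := natDegree_expand k h
    rw [← hgh, hd, mul_comm] at this
    exact (Nat.eq_of_mul_eq_mul_right hk this).symm
  have hhm : h.Monic := by
    have := hg
    rw [hgh] at this
    exact (monic_expand_iff hk).1 this
  let L := AlgebraicClosure K
  let φ : K →+* L := algebraMap K L
  -- Since `g = h(X^k)`, a root `y = x^k` of `h` yields a root `x` of `g`, and the divisibility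
  -- gives `x^k = u`. So `u` is the only root of `h`.
  have hroots : ∀ y ∈ (h.map φ).roots, y = φ u := by
    intro y hy
    have hy0 : (h.map φ).eval y = 0 := (mem_roots'.1 hy).2
    obtain ⟨x, hx⟩ := IsAlgClosed.exists_pow_nat_eq y hk
    have h1 : (g.map φ).eval x = 0 := by
      rw [hgh, map_expand, expand_eval, hx, hy0]
    obtain ⟨q, hq⟩ := hdvd
    have h2 := congrArg (fun p => (p.map φ).eval x) hq
    simp only [Polynomial.map_pow, Polynomial.map_sub, map_X, map_C, eval_pow, eval_sub, eval_X,
      eval_C, Polynomial.map_mul, eval_mul, h1, zero_mul, hx] at h2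
    exact sub_eq_zero.1 (eq_zero_of_pow_eq_zero h2)
  have hsplit := IsAlgClosed.splits (h.map φ)
  have hcard : (h.map φ).roots.card = d := by
    rw [← hsplit.natDegree_eq_card_roots, natDegree_map, hhd]
  have hh : h = (X - C u) ^ d := by
    apply map_injective φ φ.injective
    rw [hsplit.eq_prod_roots_of_monic (hhm.map φ), Multiset.eq_replicate.2 ⟨hcard, hroots⟩]
    simp
  rw [hgh, hh]
  simp

/-! ### Weights in the characteristic polynomial -/

/-- The matrix of multiplication by `b ξ ^ n` on `K[ξ] / (a ξ ^ m - 1)`. -/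
def shiftMatrix {K : Type*} [Field K] (m n : ℕ) (a b : K) : Matrix (Fin m) (Fin m) K :=
  Matrix.of fun i j => if (j : ℕ) = (i + n) % m then b * a⁻¹ ^ ((i + n) / m) else 0

/-- The power is multiplication by `b^k ξ^(k n)`: exponents are reduced modulo `m`, and each carry
contributes a factor `ξ^m = a⁻¹`. -/
theorem shiftMatrix_pow {K : Type*} [Field K] {m : ℕ} (hm : 0 < m) (n : ℕ) (a b : K) (k : ℕ) :
    shiftMatrix m n a b ^ k = Matrix.of fun i j : Fin m =>
      if (j : ℕ) = (i + k * n) % m then b ^ k * a⁻¹ ^ ((i + k * n) / m) else 0 := by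
  induction k with
  | zero =>
    ext i j
    simp [Matrix.one_apply, Nat.mod_eq_of_lt i.2, Nat.div_eq_of_lt i.2, Fin.ext_iff, eq_comm]
  | succ k ih =>
    ext i j
    rw [pow_succ, ih, Matrix.mul_apply]
    rw [Finset.sum_eq_single ⟨(i + k * n) % m, Nat.mod_lt _ hm⟩]
    · simp only [Matrix.of_apply, shiftMatrix, if_true]
      have h1 : ((i + k * n) % m + n) % m = (i + (k + 1) * n) % m := by
        rw [Nat.mod_add_mod]; ring_nf
      have h2 : (i + k * n) / m + ((i + k * n) % m + n) / m = (i + (k + 1) * n) / m := by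
        have h3 : (i : ℕ) + (k + 1) * n = ((i + k * n) % m + n) + m * ((i + k * n) / m) := by
          have := Nat.mod_add_div (i + k * n) m
          rw [add_mul, one_mul]
          omega
        rw [h3, Nat.add_mul_div_left _ _ hm, add_comm]
      rw [h1, ← h2, mul_ite, mul_zero]
      split_ifs
      · ring
      · rfl
    · intro l _ hl
      rw [Matrix.of_apply, if_neg, zero_mul]
      exact fun h => hl (Fin.ext h)
    · simp

theorem shiftMatrix_pow_eq_scalar {K : Type*} [Field K] {m : ℕ} (hm : 0 < m) (n : ℕ) (a b : K) :
    shiftMatrix m n a b ^ (m / m.gcd n) =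
      Matrix.scalar (Fin m) (b ^ (m / m.gcd n) * a⁻¹ ^ (n / m.gcd n)) := by
  have h : m / m.gcd n * n = m * (n / m.gcd n) := by
    rw [Nat.div_mul_right_comm (Nat.gcd_dvd_left m n), Nat.mul_div_assoc _ (Nat.gcd_dvd_right m n)]
  rw [shiftMatrix_pow hm]
  ext i j
  simp only [Matrix.of_apply, Matrix.scalar_apply, Matrix.diagonal_apply, h, Nat.add_mul_mod_self_left,
    Nat.mod_eq_of_lt i.2, Nat.add_mul_div_left _ _ hm, Nat.div_eq_of_lt i.2, Fin.ext_iff, zero_add,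
    eq_comm]

/-- The substitution `λ ↦ s ^ m` from `K[λ]` to `K[μ][s]`. -/
def substPow (K : Type*) [Field K] (m : ℕ) : K[X] →+* K[X][X] :=
  (expand K[X] m).toRingHom.comp (mapRingHom C)

theorem coeff_substPow {K : Type*} [Field K] {m : ℕ} (hm : 0 < m) (p : K[X]) (k : ℕ) :
    (substPow K m p).coeff k = if m ∣ k then C (p.coeff (k / m)) else 0 := by
  simp [substPow, coeff_expand hm]

/-- The substitution `λ ↦ s^m`, `μ ↦ μ s^n` sends `λ^l μ^k` to `μ^k s^(m l + n k)`. Weight becomes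
degree in `s`, and the retained power of `μ` keeps the monomials of equal weight apart. -/
theorem coeff_coeff_eval₂_substPow {K : Type*} [Field K] {m : ℕ} (hm : 0 < m) (n : ℕ) (f : K[X][X])
    (N k : ℕ) : ((f.eval₂ (substPow K m) (C X * X ^ n)).coeff N).coeff k =
      if n * k ≤ N ∧ m ∣ N - n * k then (f.coeff k).coeff ((N - n * k) / m) else 0 := by
  induction f using Polynomial.induction_on' with
  | add f g hf hg =>
    rw [eval₂_add, coeff_add, coeff_add, hf, hg, coeff_add, coeff_add]
    split_ifs <;> simp
  | monomial l p =>
    have h : (substPow K m p) * (C X * X ^ n) ^ l = C (X ^ l) * (substPow K m p * X ^ (n * l)) := by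
      rw [mul_pow, ← pow_mul, C_pow]; ring
    rw [eval₂_monomial, h, coeff_C_mul, coeff_mul_X_pow', X_pow_mul, coeff_mul_X_pow',
      coeff_monomial]
    by_cases hl : l = k
    · subst hl
      simp only [le_refl, if_true, tsub_self]
      by_cases h1 : n * l ≤ N
      · simp only [h1, if_true, true_and, coeff_substPow hm]
        split_ifs <;> simp
      · simp [h1]
    · rw [if_neg hl]
      simp only [coeff_zero, ite_self]
      split_ifs with h1 h2
      · rw [coeff_substPow hm]
        split_ifs
        · rw [coeff_C, if_neg (by omega)]
        · simp
      · simp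
      · rfl

/-- The characteristic polynomial of a matrix over `K[λ]` whose `(i, j)` entry has weight at most
`n + i - j`, where `λ` has weight `m`, with the leading parts being those of `b ξ ^ n`. -/
theorem charpoly_weights {K : Type*} [Field K] {m : ℕ} (hm : 0 < m) (n : ℕ) (a b : K)
    (B : Matrix (Fin m) (Fin m) K[X])
    (hB : ∀ (i j : Fin m) (q : ℕ), n + (i : ℕ) < m * q + j → (B i j).coeff q = 0)
    (hB' : ∀ (i j : Fin m) (q : ℕ), m * q + (j : ℕ) = n + i → (B i j).coeff q = b * a⁻¹ ^ q) :
    (∀ k l, m * n < m * l + n * k → (B.charpoly.coeff k).coeff l = 0) ∧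
    (∀ k l, m * l + n * k = m * n → (B.charpoly.coeff k).coeff l =
      ((X ^ (m / m.gcd n) - C (b ^ (m / m.gcd n) * a⁻¹ ^ (n / m.gcd n))) ^ m.gcd n).coeff k) := by
  -- The matrix `μ s^n - B(s^m)`. Its `(i, j)` entry has degree at most `n + i - j` in `s`, and the
  -- coefficients there form the characteristic matrix of `shiftMatrix m n a b`.
  let M : Matrix (Fin m) (Fin m) K[X][X] :=
    Matrix.scalar (Fin m) (C X * X ^ n) - (substPow K m).mapMatrix B
  have hdet : M.det = B.charpoly.eval₂ (substPow K m) (C X * X ^ n) := by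
    change _ = eval₂RingHom (substPow K m) (C X * X ^ n) _
    rw [Matrix.charpoly, RingHom.map_det]
    congr 1
    ext i j : 2
    simp only [M, Matrix.charmatrix, RingHom.mapMatrix_apply, Matrix.map_apply, Matrix.sub_apply,
      Matrix.scalar_apply, Matrix.diagonal_apply, map_sub]
    simp [apply_ite (eval₂ (substPow K m) (C X * X ^ n))]
  have hM : ∀ (i j : Fin m) (k : ℕ), (M i j).coeff k =
      (if i = j ∧ k = n then X else 0) - if m ∣ k then C ((B i j).coeff (k / m)) else 0 := by
    intro i j k
    simp only [M, Matrix.sub_apply, RingHom.mapMatrix_apply, Matrix.map_apply, coeff_sub,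
      coeff_substPow hm, Matrix.scalar_apply, Matrix.diagonal_apply]
    congr 1
    by_cases hij : i = j
    · simp [hij, coeff_X_pow]
    · simp [hij]
  obtain ⟨h1, h2⟩ := det_coeff_mul_of_shifted n M (fun i j k hk => by
    rw [hM, if_neg, zero_sub, neg_eq_zero]
    · split_ifs with h
      · rw [hB i j (k / m), C_0]
        rwa [Nat.mul_div_cancel' h]
      · rfl
    · rintro ⟨rfl, rfl⟩
      omega)
  have hT : (Matrix.of fun i j : Fin m =>
      if (j : ℕ) ≤ n + i then (M i j).coeff (n + i - j) else 0) =
      (shiftMatrix m n a b).charmatrix := by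
    refine Matrix.ext fun i j => ?_
    simp only [Matrix.of_apply, Matrix.charmatrix_apply, Matrix.diagonal_apply, hM, shiftMatrix]
    have hmod := Nat.mod_add_div ((i : ℕ) + n) m
    by_cases hj : (j : ℕ) ≤ n + i
    · rw [if_pos hj]
      refine congrArg₂ (fun x y : K[X] => x - y) ?_ ?_
      · by_cases hij : i = j
        · simp [hij]
        · simp [hij]
      · by_cases hd : m ∣ n + i - j
        · obtain ⟨q, hq⟩ := hd
          have hq' : (i : ℕ) + n = j + m * q := by omega
          rw [if_pos ⟨q, hq⟩, hq, Nat.mul_div_cancel_left _ hm, hB' i j q (by omega), hq',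
            Nat.add_mul_mod_self_left, Nat.mod_eq_of_lt j.2, if_pos rfl,
            Nat.add_mul_div_left _ _ hm, Nat.div_eq_of_lt j.2, zero_add]
        · rw [if_neg hd, if_neg, C_0]
          intro h
          exact hd ⟨((i : ℕ) + n) / m, by omega⟩
    -- Here `n + i - j` would be negative, and the entry of the shift matrix is zero as well because
    -- `(i + n) % m ≤ i + n < j`.
    · have hij : i ≠ j := by
        rintro rfl
        omega
      rw [if_neg hj, if_neg hij, if_neg, C_0, sub_zero]
      intro h
      have := Nat.mod_le ((i : ℕ) + n) m
      omega
  rw [hT, hdet] at h2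
  rw [hdet] at h1
  have hcoeff : ∀ k l, ((B.charpoly.eval₂ (substPow K m) (C X * X ^ n)).coeff
      (m * l + n * k)).coeff k = (B.charpoly.coeff k).coeff l := by
    intro k l
    rw [coeff_coeff_eval₂_substPow hm, if_pos ⟨by omega, by simp⟩]
    simp [Nat.mul_div_cancel_left _ hm]
  have hcard : Fintype.card (Fin m) = m := Fintype.card_fin m
  have hgcd : 0 < m.gcd n := Nat.gcd_pos_of_pos_left _ hm
  have hpow : (shiftMatrix m n a b).charpoly =
      (X ^ (m / m.gcd n) - C (b ^ (m / m.gcd n) * a⁻¹ ^ (n / m.gcd n))) ^ m.gcd n := by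
    refine eq_pow_of_dvd_pow (Nat.div_pos (Nat.gcd_le_left _ hm) hgcd)
      (Matrix.charpoly_monic _) ?_ ?_
      (charpoly_dvd_of_pow_eq _ _ _ (shiftMatrix_pow_eq_scalar hm n a b))
    · rw [Matrix.charpoly_natDegree_eq_dim, hcard, Nat.div_mul_cancel (Nat.gcd_dvd_left _ _)]
    -- By weight, a nonzero coefficient of `μ^k` requires `m ∣ m n - n k`, hence `m ∣ n k` and `m/d
    -- ∣ k`.
    · intro k hk
      rw [Matrix.charpoly, ← h2, coeff_coeff_eval₂_substPow hm] at hk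
      split_ifs at hk with h
      · have h3 : m ∣ n * k := by
          have := (Nat.dvd_sub_iff_right h.1 (Dvd.intro _ rfl : m ∣ m * n)).1 h.2
          exact this
        exact (Nat.Coprime.dvd_of_dvd_mul_left (Nat.coprime_div_gcd_div_gcd hgcd)
          (by
            have h4 := Nat.div_dvd_div (Nat.gcd_dvd_left m n) h3
            rwa [← Nat.div_mul_right_comm (Nat.gcd_dvd_right m n)] at h4))
      · exact absurd rfl hk
  constructor
  · intro k l h
    rw [← hcoeff, h1 _ h, coeff_zero]
  · intro k l h
    rw [← hcoeff, h, h2, ← hpow, Matrix.charpoly]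

theorem eq_zero_of_natCast_succ_mul (K : Type*) {A : Type*} [Field K] [CharZero K] [CommRing A]
    [Algebra K A] {a : A} (i : ℕ) (h : ((i : A) + 1) * a = 0) : a = 0 := by
  have h1 : ((i : K) + 1) • a = 0 := by
    rw [Algebra.smul_def]
    simpa using h
  exact (smul_eq_zero.1 h1).resolve_left (Nat.cast_add_one_ne_zero i)

/-! ### The order filtration and highest coefficients -/

section Filtration

variable {K A : Type*} [Field K] [CommRing A] [Algebra K A] {D : Module.End K A}

/-- The operators `∑ a_i D ^ i` of order less than `N`. -/
def opsLT (D : Module.End K A) (N : ℕ) : Submodule A (Module.End K A) :=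
  Submodule.span A ((fun i => D ^ i) '' Set.Iio N)

/-- `W` is an operator of order at most `N` in which `D ^ N` has coefficient `a`. -/
def HasSymbol (D : Module.End K A) (N : ℕ) (a : A) (W : Module.End K A) : Prop :=
  W - a • D ^ N ∈ opsLT D N

theorem opsLT_mono {M N : ℕ} (h : M ≤ N) : opsLT D M ≤ opsLT D N :=
  Submodule.span_mono (Set.image_mono (Set.Iio_subset_Iio h))

theorem opsLT_zero : opsLT D 0 = ⊥ := by simp [opsLT]

theorem pow_mem_opsLT {i N : ℕ} (h : i < N) : D ^ i ∈ opsLT D N :=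
  Submodule.subset_span ⟨i, h, rfl⟩

theorem hasSymbol_pow (N : ℕ) : HasSymbol D N 1 (D ^ N) := by
  simp [HasSymbol]

theorem hasSymbol_sum {N : ℕ} (a : Fin (N + 1) → A) :
    HasSymbol D N (a (Fin.last N)) (∑ i, a i • D ^ (i : ℕ)) := by
  rw [HasSymbol, Fin.sum_univ_castSucc, Fin.val_last, add_sub_cancel_right]
  exact Submodule.sum_mem _ fun i _ => Submodule.smul_mem _ _ (pow_mem_opsLT i.2)

theorem HasSymbol.mem {N : ℕ} {a : A} {W : Module.End K A} (h : HasSymbol D N a W) :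
    W ∈ opsLT D (N + 1) := by
  rw [← sub_add_cancel W (a • D ^ N)]
  exact add_mem (opsLT_mono N.le_succ h) (Submodule.smul_mem _ _ (pow_mem_opsLT N.lt_succ_self))

theorem exists_hasSymbol {N : ℕ} {W : Module.End K A} (h : W ∈ opsLT D (N + 1)) :
    ∃ a, HasSymbol D N a W := by
  have hs : (fun i => D ^ i) '' Set.Iio (N + 1) = insert (D ^ N) ((fun i => D ^ i) '' Set.Iio N) := by
    rw [← Set.image_insert_eq]
    congr 1
    ext i
    simp only [Set.mem_Iio, Set.mem_insert_iff]
    omega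
  rw [opsLT, hs, Submodule.mem_span_insert] at h
  obtain ⟨a, V, hV, rfl⟩ := h
  exact ⟨a, by simpa [HasSymbol] using! hV⟩

section Leibniz

variable (hD : ∀ a b, D (a * b) = a * D b + D a * b)
include hD

theorem mul_smul_eq (a : A) (W : Module.End K A) : D * a • W = a • (D * W) + D a • W := by
  ext x
  simp [hD]

theorem mul_mem_opsLT_succ {N : ℕ} {W : Module.End K A} (h : W ∈ opsLT D N) :
    D * W ∈ opsLT D (N + 1) := by
  induction h using Submodule.span_induction with
  | mem W hW =>
    obtain ⟨i, hi, rfl⟩ := hW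
    change D * D ^ i ∈ _
    rw [← pow_succ']
    exact pow_mem_opsLT (Nat.succ_lt_succ hi)
  | zero => simp
  | add V W _ _ hV hW => rw [mul_add]; exact add_mem hV hW
  | smul a W hW ih =>
    rw [mul_smul_eq hD]
    exact add_mem (Submodule.smul_mem _ _ ih) (Submodule.smul_mem _ _ (opsLT_mono N.le_succ hW))

theorem pow_mul_mem_opsLT {N : ℕ} {W : Module.End K A} (h : W ∈ opsLT D N) (i : ℕ) :
    D ^ i * W ∈ opsLT D (N + i) := by
  induction i with
  | zero => simpa
  | succ i ih =>
    rw [pow_succ', mul_assoc]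
    exact mul_mem_opsLT_succ hD ih

theorem mul_mem_opsLT {M N : ℕ} {V W : Module.End K A} (hV : V ∈ opsLT D M)
    (hW : W ∈ opsLT D (N + 1)) : V * W ∈ opsLT D (M + N) := by
  induction hV using Submodule.span_induction with
  | mem V hV =>
    obtain ⟨i, hi, rfl⟩ := hV
    have hi' : i < M := hi
    exact opsLT_mono (by omega) (pow_mul_mem_opsLT hD hW i)
  | zero => simp
  | add V V' _ _ hV hV' => rw [add_mul]; exact add_mem hV hV'
  | smul a V _ ih => rw [smul_mul_assoc]; exact Submodule.smul_mem _ _ ih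

/-- Moving `D` past `b` produces only the extra term `D b • D^(N+i)`, which is of lower order than
the new leading term. -/
theorem HasSymbol.pow_mul {N : ℕ} {b : A} {W : Module.End K A} (h : HasSymbol D N b W) (i : ℕ) :
    HasSymbol D (N + i) b (D ^ i * W) := by
  induction i with
  | zero => simpa
  | succ i ih =>
    have h1 := mul_mem_opsLT_succ hD ih
    rw [mul_sub, mul_smul_eq hD, ← mul_assoc, ← pow_succ', ← pow_succ'] at h1
    have h2 : D b • D ^ (N + i) ∈ opsLT D (N + (i + 1)) :=
      Submodule.smul_mem _ _ (pow_mem_opsLT (by omega))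
    have h3 := add_mem h1 h2
    rwa [sub_add_eq_sub_sub, sub_add_cancel] at h3

theorem HasSymbol.mul {M N : ℕ} {a b : A} {V W : Module.End K A} (hV : HasSymbol D M a V)
    (hW : HasSymbol D N b W) : HasSymbol D (M + N) (a * b) (V * W) := by
  have h1 := mul_mem_opsLT hD hV hW.mem
  have h2 := Submodule.smul_mem _ a (hW.pow_mul hD M)
  rw [add_comm N M] at h2
  have h3 := add_mem h1 h2
  rwa [sub_mul, smul_mul_assoc, smul_sub, smul_smul, sub_add_sub_cancel] at h3

theorem HasSymbol.pow {N : ℕ} {a : A} {W : Module.End K A} (h : HasSymbol D N a W) (q : ℕ) :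
    HasSymbol D (N * q) (a ^ q) (W ^ q) := by
  induction q with
  | zero => simpa using hasSymbol_pow (D := D) 0
  | succ q ih =>
    rw [pow_succ, pow_succ, mul_add, mul_one]
    exact ih.mul hD h

end Leibniz

/-- The commutator with multiplication by `z`. -/
def commMul (z : A) : Module.End K A →ₗ[A] Module.End K A :=
  LinearMap.mulRight A (LinearMap.mulLeft K z) - LinearMap.lsmul A _ z

theorem commMul_apply (z : A) (W : Module.End K A) (x : A) :
    commMul z W x = W (z * x) - z * W x := rfl

section Coordinate

variable (hD : ∀ a b, D (a * b) = a * D b + D a * b) {z : A} (hz : D z = 1)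
include hD hz

/-- The commutator with `z` acts as formal differentiation with respect to `D`; this is what allows
induction on the order. -/
theorem commMul_pow_succ (i : ℕ) : commMul z (D ^ (i + 1)) = ((i : A) + 1) • D ^ i := by
  induction i with
  | zero =>
    ext x
    simp [commMul_apply, hD, hz]
  | succ i ih =>
    ext x
    have h1 := LinearMap.congr_fun ih (D x)
    have h2 := LinearMap.congr_fun ih x
    simp only [commMul_apply, LinearMap.smul_apply, smul_eq_mul] at h1 h2 ⊢
    rw [pow_succ _ (i + 1), Module.End.mul_apply, Module.End.mul_apply, hD, hz, one_mul, map_add]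
    rw [pow_succ _ i] at h1 ⊢
    simp only [Module.End.mul_apply] at h1 ⊢
    push_cast
    linear_combination h1

theorem commMul_mem {N : ℕ} {W : Module.End K A} (h : W ∈ opsLT D (N + 1)) :
    commMul z W ∈ opsLT D N := by
  induction h using Submodule.span_induction with
  | mem W hW =>
    obtain ⟨i, hi, rfl⟩ := hW
    have hi' : i < N + 1 := hi
    rcases i with _ | i
    · have h0 : commMul z (D ^ 0) = 0 := by
        ext x
        simp [commMul_apply]
      change commMul z (D ^ 0) ∈ _
      rw [h0]
      exact zero_mem _
    · change commMul z (D ^ (i + 1)) ∈ _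
      rw [commMul_pow_succ hD hz]
      exact Submodule.smul_mem _ _ (pow_mem_opsLT (by omega))
  | zero => simp
  | add V W _ _ hV hW => rw [map_add]; exact add_mem hV hW
  | smul a W _ ih => rw [map_smul]; exact Submodule.smul_mem _ _ ih

variable [CharZero K]

/-- Zero divisors in `A` are allowed. Each commutator with `z` lowers the order by one and brings in
a positive integer factor, cancelled in characteristic zero, until only `a • 1 = 0` is left. -/
theorem eq_zero_of_smul_pow_mem {N : ℕ} {a : A} (h : a • D ^ N ∈ opsLT D N) : a = 0 := by
  induction N generalizing a with
  | zero =>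
    rw [opsLT_zero, Submodule.mem_bot] at h
    simpa using LinearMap.congr_fun h 1
  | succ N ih =>
    have h1 := commMul_mem hD hz h
    rw [map_smul, commMul_pow_succ hD hz, smul_smul, mul_comm] at h1
    exact eq_zero_of_natCast_succ_mul K N (ih h1)

theorem HasSymbol.unique {N : ℕ} {a b : A} {W : Module.End K A} (ha : HasSymbol D N a W)
    (hb : HasSymbol D N b W) : a = b := by
  have h := sub_mem hb ha
  rw [sub_sub_sub_cancel_left] at h
  have h' : (a - b) • D ^ N = a • D ^ N - b • D ^ N := by
    ext x
    simp [sub_mul]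
  rw [← h'] at h
  exact sub_eq_zero.1 (eq_zero_of_smul_pow_mem hD hz h)

/-- A differential operator which annihilates all powers of the coordinate vanishes. -/
theorem eq_zero_of_apply_pow {N : ℕ} {W : Module.End K A} (hW : W ∈ opsLT D N)
    (h : ∀ k, W (z ^ k) = 0) : W = 0 := by
  induction N generalizing W with
  | zero => rwa [opsLT_zero, Submodule.mem_bot] at hW
  | succ N ih =>
    -- The commutator with `z` again annihilates all powers of `z` and has smaller order. So `W`
    -- commutes with `z`, which excludes a nonzero term of positive order; order zero is settled by
    -- `W 1 = 0`.
    have h0 : commMul z W = 0 := ih (commMul_mem hD hz hW) fun k => by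
      rw [commMul_apply, ← pow_succ', h, h, mul_zero, sub_zero]
    obtain ⟨a, ha⟩ := exists_hasSymbol hW
    suffices a = 0 by
      subst this
      exact ih (by simpa [HasSymbol] using ha) h
    rcases N with _ | N
    · rw [HasSymbol, opsLT_zero, Submodule.mem_bot, sub_eq_zero] at ha
      have := h 0
      rw [ha] at this
      simpa using this
    · have h1 := commMul_mem hD hz ha
      rw [map_sub, h0, zero_sub, map_smul, commMul_pow_succ hD hz, smul_smul, neg_mem_iff,
        mul_comm] at h1
      exact eq_zero_of_natCast_succ_mul K N (eq_zero_of_smul_pow_mem hD hz h1)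

theorem eq_of_apply_pow_eq {N : ℕ} {V W : Module.End K A} (hV : V ∈ opsLT D N)
    (hW : W ∈ opsLT D N) (h : ∀ k, V (z ^ k) = W (z ^ k)) : V = W :=
  sub_eq_zero.1 (eq_zero_of_apply_pow hD hz (sub_mem hV hW) fun k => by
    rw [LinearMap.sub_apply, h, sub_self])

end Coordinate

end Filtration

/-! ### Division by powers of `P`: the operators as a free module over `A[λ]` -/

section Division

variable {K A : Type*} [Field K] [CommRing A] [Algebra K A] {D : Module.End K A}

/-- The operators as a module over `A[λ]`, with `λ` acting by multiplication by `P` from the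
right. -/
abbrev OpModule (P : Module.End K A) := Module.AEval' (LinearMap.mulRight A P)

/-- The identification of operators with elements of the module `OpModule P`. -/
abbrev toOpModule (P : Module.End K A) : Module.End K A ≃ₗ[A] OpModule P :=
  Module.AEval'.of (LinearMap.mulRight A P)

theorem monomial_smul_toOpModule (P W : Module.End K A) (q : ℕ) (c : A) :
    (monomial q c : A[X]) • toOpModule P W = toOpModule P (c • (W * P ^ q)) := by
  have h : ∀ q : ℕ, (X ^ q : A[X]) • toOpModule P W = toOpModule P (W * P ^ q) := by
    intro q
    induction q with
    | zero => simp
    | succ q ih =>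
      rw [pow_succ', mul_smul, ih, Module.AEval.X_smul_of, pow_succ, ← mul_assoc]
      rfl
  rw [← C_mul_X_pow_eq_monomial, mul_smul, h, Module.AEval.C_smul, map_smul]

theorem smul_toOpModule (P W : Module.End K A) (p : A[X]) :
    p • toOpModule P W = toOpModule P (p.sum fun q c => c • (W * P ^ q)) := by
  conv_lhs => rw [p.as_sum_support]
  rw [Finset.sum_smul, Polynomial.sum, map_sum]
  exact Finset.sum_congr rfl fun q _ => monomial_smul_toOpModule P W q _

/-- The `A[λ]`-linear combinations of `1, D, …, D ^ (m - 1)`. -/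
def combo (D P : Module.End K A) (m : ℕ) : (Fin m → A[X]) →ₗ[A[X]] OpModule P :=
  Fintype.linearCombination A[X] fun j : Fin m => toOpModule P (D ^ (j : ℕ))

theorem combo_apply (D P : Module.End K A) {m : ℕ} (v : Fin m → A[X]) :
    combo D P m v = ∑ j, v j • toOpModule P (D ^ (j : ℕ)) := rfl

theorem combo_single (D P : Module.End K A) {m : ℕ} (j : Fin m) (p : A[X]) :
    combo D P m (Pi.single j p) = p • toOpModule P (D ^ (j : ℕ)) := by
  simp [combo]

variable {m : ℕ} {P : Module.End K A} {α α' : A}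
  (hD : ∀ a b, D (a * b) = a * D b + D a * b) (hP : HasSymbol D m α P)
include hD hP

theorem hasSymbol_pow_mul_pow (j q : ℕ) : HasSymbol D (m * q + j) (α ^ q) (D ^ j * P ^ q) :=
  (hP.pow hD q).pow_mul hD j

theorem combo_mem_opsLT {N : ℕ} {v : Fin m → A[X]}
    (hv : ∀ (j : Fin m) (q : ℕ), N ≤ m * q + j → (v j).coeff q = 0) :
    (toOpModule P).symm (combo D P m v) ∈ opsLT D N := by
  rw [combo_apply, map_sum]
  refine Submodule.sum_mem _ fun j _ => ?_
  rw [smul_toOpModule, LinearEquiv.symm_apply_apply]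
  refine Submodule.sum_mem _ fun q hq => Submodule.smul_mem _ _ ?_
  refine opsLT_mono ?_ (hasSymbol_pow_mul_pow hD hP j q).mem
  by_contra h
  exact mem_support_iff.1 hq (hv j q (by omega))

variable (hα : α * α' = 1)
include hα

/-- Division by powers of `P`. -/
theorem exists_combo (hm : 0 < m) {N : ℕ} {W : Module.End K A} (hW : W ∈ opsLT D N) :
    ∃ v : Fin m → A[X], combo D P m v = toOpModule P W ∧
      ∀ (j : Fin m) (q : ℕ), N ≤ m * q + j → (v j).coeff q = 0 := by
  induction N generalizing W with
  | zero =>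
    rw [opsLT_zero, Submodule.mem_bot] at hW
    exact ⟨0, by simp [hW], by simp⟩
  | succ N ih =>
    obtain ⟨a, ha⟩ := exists_hasSymbol hW
    -- With `N = m q + j₀`, the operator `D^j₀ P^q` has leading coefficient `α^q` in order `N`, so
    -- `a α'^q` times it cancels the leading term of `W`.
    let j₀ : Fin m := ⟨N % m, Nat.mod_lt _ hm⟩
    have hN : m * (N / m) + j₀ = N := by
      have := Nat.mod_add_div N m
      change _ + N % m = N
      omega
    have h1 := hasSymbol_pow_mul_pow hD hP j₀ (N / m)
    rw [hN] at h1
    have h2 := sub_mem ha (Submodule.smul_mem _ (a * α' ^ (N / m)) h1)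
    have h3 : a * α' ^ (N / m) * α ^ (N / m) = a := by
      rw [mul_assoc, ← mul_pow, mul_comm α', hα, one_pow, mul_one]
    rw [smul_sub, smul_smul, h3, sub_sub_sub_cancel_right] at h2
    obtain ⟨v, hv, hv'⟩ := ih h2
    refine ⟨v + Pi.single j₀ (monomial (N / m) (a * α' ^ (N / m))), ?_, ?_⟩
    · rw [map_add, hv, combo_single, monomial_smul_toOpModule, ← map_add, sub_add_cancel]
    · intro j q hq
      rw [Pi.add_apply, coeff_add, hv' j q (by omega), zero_add]
      by_cases hj : j = j₀
      · subst hj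
        rw [Pi.single_eq_same, coeff_monomial, if_neg]
        rintro rfl
        omega
      · simp [Pi.single_eq_of_ne hj]

variable [CharZero K] {z : A} (hz : D z = 1)
include hz

/-- As `j < m`, the weight `m q + j` determines both `j` and `q`. Only one term of the combination
reaches order `N`, so its coefficient can be read off from the symbol. -/
theorem combo_coeff_eq {N : ℕ} {a : A} {v : Fin m → A[X]}
    (hv : ∀ (j : Fin m) (q : ℕ), N < m * q + j → (v j).coeff q = 0)
    (ha : HasSymbol D N a ((toOpModule P).symm (combo D P m v))) {j : Fin m} {q : ℕ}
    (hq : m * q + j = N) : (v j).coeff q = a * α' ^ q := by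
  set c := (v j).coeff q with hc
  have h1 : (toOpModule P).symm (combo D P m (v - Pi.single j (monomial q c))) ∈ opsLT D N := by
    refine combo_mem_opsLT hD hP fun i k hk => ?_
    rw [Pi.sub_apply, coeff_sub]
    by_cases hi : i = j
    · subst hi
      rw [Pi.single_eq_same, coeff_monomial]
      split_ifs with hqk
      · rw [← hqk, ← hc, sub_self]
      · rw [sub_zero]
        refine hv _ _ (lt_of_le_of_ne hk fun h => hqk ?_)
        exact Nat.eq_of_mul_eq_mul_left (Nat.zero_lt_of_lt i.2) (by omega)
    · rw [Pi.single_eq_of_ne hi, coeff_zero, sub_zero]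
      refine hv _ _ (lt_of_le_of_ne hk fun h => hi ?_)
      have h2 : (m * q + j) % m = (m * k + i) % m := by rw [hq, h]
      rw [Nat.mul_add_mod, Nat.mul_add_mod, Nat.mod_eq_of_lt i.2, Nat.mod_eq_of_lt j.2] at h2
      exact Fin.ext h2.symm
  rw [map_sub, combo_single, monomial_smul_toOpModule, map_sub, LinearEquiv.symm_apply_apply] at h1
  have h2 := hasSymbol_pow_mul_pow hD hP j q
  rw [hq] at h2
  have h3 := add_mem h1 (Submodule.smul_mem _ c h2)
  rw [smul_sub, smul_smul, sub_add_sub_cancel] at h3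
  rw [ha.unique hD hz h3, mul_assoc, ← mul_pow, hα, one_pow, mul_one]

theorem combo_injective : Function.Injective (combo D P m) := by
  rw [injective_iff_map_eq_zero]
  intro v hv
  suffices h : ∀ N, (∀ (j : Fin m) (q : ℕ), N ≤ m * q + j → (v j).coeff q = 0) → v = 0 by
    -- A bound above all weights that occur in `v`; the induction then lowers it to zero.
    refine h (m * (∑ j, (v j).natDegree + 1)) fun j q hq => coeff_eq_zero_of_natDegree_lt ?_
    have h1 : (v j).natDegree ≤ ∑ j, (v j).natDegree :=
      Finset.single_le_sum (f := fun j => (v j).natDegree) (fun _ _ => Nat.zero_le _)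
        (Finset.mem_univ j)
    by_contra! h2
    have h3 : m * (q + 1) ≤ m * (∑ j, (v j).natDegree + 1) := by gcongr; omega
    have := j.2
    have h4 : m * (q + 1) = m * q + m := mul_add_one m q
    linarith
  intro N
  induction N with
  | zero =>
    intro h
    ext j q
    exact h j q (Nat.zero_le _)
  | succ N ih =>
    intro h
    refine ih fun j q hq => ?_
    rcases hq.eq_or_lt with hq | hq
    · have h0 : HasSymbol D N 0 ((toOpModule P).symm (combo D P m v)) := by
        simp [HasSymbol, hv]
      rw [combo_coeff_eq hD hP hα hz (fun i k hk => h i k hk) h0 hq.symm, zero_mul]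
    · exact h j q hq

end Division

/-! ### The connection given by `D`, and constancy of the characteristic polynomial -/

section Connection

variable {K A : Type*} [Field K] [CommRing A] [Algebra K A] {D : Module.End K A}

/-- The coefficientwise extension of a derivation to polynomials, in the form of a ring
homomorphism into the dual numbers. -/
theorem exists_dualNumber_lift (hD : ∀ a b, D (a * b) = a * D b + D a * b) :
    ∃ τ : A[X] →+* DualNumber A[X], (∀ p, (τ p).fst = p) ∧
      ∀ p k, (τ p).snd.coeff k = D (p.coeff k) := by
  have hD1 : D 1 = 0 := by simpa using hD 1 1
  let τ₀ : A →+* DualNumber A[X] :=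
    { toFun := fun a => TrivSqZeroExt.inl (C a) + TrivSqZeroExt.inr (C (D a))
      map_zero' := by ext <;> simp
      map_one' := by ext <;> simp [hD1]
      map_add' := fun a b => by ext <;> simp
      map_mul' := fun a b => by ext <;> simp [hD, mul_comm] }
  have hτ₀ : ∀ a, τ₀ a = TrivSqZeroExt.inl (C a) + TrivSqZeroExt.inr (C (D a)) := fun _ => rfl
  let τ : A[X] →+* DualNumber A[X] := eval₂RingHom τ₀ (TrivSqZeroExt.inl X)
  have hτ : ∀ k a, τ (monomial k a) = TrivSqZeroExt.inl (monomial k a) +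
      TrivSqZeroExt.inr (monomial k (D a)) := by
    intro k a
    rw [coe_eval₂RingHom, eval₂_monomial, hτ₀, TrivSqZeroExt.inl_pow, add_mul,
      ← TrivSqZeroExt.inl_mul, ← C_mul_X_pow_eq_monomial, ← C_mul_X_pow_eq_monomial]
    congr 1
    ext1 <;> simp
  refine ⟨τ, fun p => ?_, fun p k => ?_⟩
  · induction p using Polynomial.induction_on' with
    | add p q hp hq => rw [map_add, TrivSqZeroExt.fst_add, hp, hq]
    | monomial k a => simp [hτ]
  · induction p using Polynomial.induction_on' with
    | add p q hp hq => rw [map_add, TrivSqZeroExt.snd_add, coeff_add, hp, hq, coeff_add, map_add]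
    | monomial k a => simp [hτ, coeff_monomial, apply_ite D]

/-- Left multiplication by `D` commutes with right multiplication by `P`, so λ behaves as a constant
and the Leibniz rule on `A` extends to `A[λ]`: this is a connection on `OpModule P`. -/
theorem mul_smul_toOpModule (hD : ∀ a b, D (a * b) = a * D b + D a * b) (P W : Module.End K A)
    (p p' : A[X]) (hp : ∀ k, p'.coeff k = D (p.coeff k)) :
    toOpModule P (D * (toOpModule P).symm (p • toOpModule P W)) =
      p • toOpModule P (D * W) + p' • toOpModule P W := by
  have h : p' = p.sum fun q c => monomial q (D c) := by
    ext k
    rw [hp, Polynomial.sum, finsetSum_coeff]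
    simp only [coeff_monomial]
    rw [Finset.sum_ite_eq']
    split_ifs with hk
    · rfl
    · rw [notMem_support_iff.1 hk, map_zero]
  rw [h, smul_toOpModule, smul_toOpModule, LinearEquiv.symm_apply_apply, Polynomial.sum,
    Polynomial.sum, Polynomial.sum, Finset.sum_smul]
  simp only [monomial_smul_toOpModule]
  rw [← map_sum, ← map_add, Finset.mul_sum, ← Finset.sum_add_distrib]
  simp only [mul_smul_eq hD, mul_assoc]

/-- Multiplication by `Q` from the right. -/
def rightMul {P Q : Module.End K A} (h : Commute P Q) : OpModule P →ₗ[A[X]] OpModule P :=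
  LinearMap.ofAEval (LinearMap.mulRight A P)
    ((toOpModule P).toLinearMap ∘ₗ LinearMap.mulRight A Q) fun W => by
      rw [LinearMap.comp_apply, LinearMap.comp_apply, LinearEquiv.coe_coe, Module.AEval.X_smul_of]
      congr 1
      change W * P * Q = W * Q * P
      rw [mul_assoc, h.eq, mul_assoc]

theorem rightMul_toOpModule {P Q : Module.End K A} (h : Commute P Q) (W : Module.End K A) :
    rightMul h (toOpModule P W) = toOpModule P (W * Q) := rfl

theorem aeval_apply_eq_sum {S M ι : Type*} [CommRing S] [AddCommGroup M] [Module S M] [Fintype ι]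
    [DecidableEq ι] (R : M →ₗ[S] M) (e : ι → M) (B : Matrix ι ι S)
    (hB : ∀ i, R (e i) = ∑ j, B i j • e j) (p : S[X]) (i : ι) :
    aeval R p (e i) = ∑ j, aeval B p i j • e j := by
  induction p using Polynomial.induction_on generalizing i with
  | C a =>
    simp [Matrix.algebraMap_matrix_apply]
  | add p q hp hq => simp [hp, hq, add_smul, Finset.sum_add_distrib]
  | monomial k a ih =>
    have h : aeval B (C a * X ^ (k + 1)) = B * aeval B (C a * X ^ k) := by
      rw [pow_succ, ← mul_assoc, mul_comm _ X, map_mul, aeval_X]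
    rw [h, pow_succ, ← mul_assoc, map_mul, aeval_X, Module.End.mul_apply, hB, map_sum]
    simp only [map_smul, ih, Matrix.mul_apply, Finset.sum_smul, Finset.smul_sum, smul_smul]
    rw [Finset.sum_comm]

/-- Cayley–Hamilton evaluated on the basis element `D^0 = 1`. Coefficients act from the left and
`P`, `Q` from the right, so the result is an identity of operators. -/
theorem sum_charpoly_eq_zero {m : ℕ} (hm : 0 < m) {P Q : Module.End K A} (h : Commute P Q)
    (B : Matrix (Fin m) (Fin m) A[X])
    (hB : ∀ i : Fin m, combo D P m (B i) = toOpModule P (D ^ (i : ℕ) * Q)) :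
    (B.charpoly.sum fun k p => p.sum fun l c => c • (Q ^ k * P ^ l)) = 0 := by
  have h1 := aeval_apply_eq_sum (rightMul h) (fun j : Fin m => toOpModule P (D ^ (j : ℕ))) B
    (fun i => by rw [rightMul_toOpModule, ← hB, combo_apply]) B.charpoly ⟨0, hm⟩
  have h2 : ∀ k W, (rightMul h ^ k) (toOpModule P W) = toOpModule P (W * Q ^ k) := by
    intro k
    induction k with
    | zero => simp
    | succ k ih =>
      intro W
      rw [pow_succ', Module.End.mul_apply, ih, rightMul_toOpModule, mul_assoc, pow_succ]
  rw [Matrix.aeval_self_charpoly, aeval_eq_sum_range, LinearMap.sum_apply] at h1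
  simp only [LinearMap.smul_apply, h2, smul_toOpModule, pow_zero, one_mul, Matrix.zero_apply,
    zero_smul, Finset.sum_const_zero, ← map_sum] at h1
  rw [LinearEquiv.map_eq_zero_iff] at h1
  rw [sum_over_range _ (fun k => by simp)]
  exact h1

/-- The operator `D D^i Q` is expanded in two ways. Expanding `D^i Q` first and then applying the
connection gives row `i` of `B Γ + B'`; expanding `D D^i` first and then multiplying by `Q` gives
row `i` of `Γ B`. Injectivity of `combo` equates them. -/
theorem charpoly_coeff_constant {m : ℕ} {P Q : Module.End K A} (h : Commute P Q)
    (hD : ∀ a b, D (a * b) = a * D b + D a * b)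
    (hinj : Function.Injective (combo D P m)) (B Γ : Matrix (Fin m) (Fin m) A[X])
    (hB : ∀ i : Fin m, combo D P m (B i) = toOpModule P (D ^ (i : ℕ) * Q))
    (hΓ : ∀ i : Fin m, combo D P m (Γ i) = toOpModule P (D * D ^ (i : ℕ))) (k l : ℕ) :
    D ((B.charpoly.coeff k).coeff l) = 0 := by
  obtain ⟨τ, hτ, hτ'⟩ := exists_dualNumber_lift hD
  rw [← hτ', snd_charpoly_coeff_eq_zero τ hτ B Γ, coeff_zero]
  intro i j
  let B' : Matrix (Fin m) (Fin m) A[X] := B.map fun p => (τ p).snd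
  have hcombo : ∀ M N : Matrix (Fin m) (Fin m) A[X], combo D P m ((M * N) i) =
      ∑ j, M i j • combo D P m (N j) := by
    intro M N
    simp only [← map_smul, ← map_sum]
    congr 1
    ext1 l
    simp [Matrix.mul_apply]
  have h1 : toOpModule P (D * (toOpModule P).symm (combo D P m (B i))) =
      combo D P m ((B * Γ) i + B' i) := by
    rw [map_add, hcombo, combo_apply, combo_apply, map_sum, Finset.mul_sum, map_sum,
      ← Finset.sum_add_distrib]
    refine Finset.sum_congr rfl fun j _ => ?_
    rw [mul_smul_toOpModule hD P _ _ _ (hτ' (B i j)), hΓ]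
    rfl
  have h2 : toOpModule P (D * (toOpModule P).symm (combo D P m (B i))) =
      combo D P m ((Γ * B) i) := by
    rw [hcombo, hB, LinearEquiv.symm_apply_apply, ← mul_assoc, ← rightMul_toOpModule h, ← hΓ,
      combo_apply, map_sum]
    refine Finset.sum_congr rfl fun j _ => ?_
    rw [map_smul, rightMul_toOpModule, hB]
  have h3 := congrFun (hinj (h1.symm.trans h2)) j
  rw [Pi.add_apply, add_comm] at h3
  exact eq_sub_of_add_eq h3

end Connection

/-! ### Polynomial relations in two variables and their weighted top part -/

section Relation

variable {K B : Type*} [Field K] [Ring B] [Algebra K B]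

theorem evalPair_add (f g : MvPolynomial (Fin 2) K) (P Q : B) :
    evalPair (f + g) P Q = evalPair f P Q + evalPair g P Q :=
  Finsupp.sum_add_index' (h := fun (e : Fin 2 →₀ ℕ) (c : K) => c • (P ^ e 0 * Q ^ e 1))
    (fun _ => zero_smul _ _) (fun _ _ _ => add_smul _ _ _)

theorem evalPair_monomial (e : Fin 2 →₀ ℕ) (c : K) (P Q : B) :
    evalPair (MvPolynomial.monomial e c) P Q = c • (P ^ e 0 * Q ^ e 1) :=
  Finsupp.sum_single_index (h := fun (e : Fin 2 →₀ ℕ) (c : K) => c • (P ^ e 0 * Q ^ e 1))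
    (zero_smul _ _)

theorem evalPair_C_mul (f : MvPolynomial (Fin 2) K) (c : K) (P Q : B) :
    evalPair (MvPolynomial.C c * f) P Q = c • evalPair f P Q := by
  induction f using MvPolynomial.induction_on' with
  | monomial e a =>
    rw [MvPolynomial.C_mul_monomial, evalPair_monomial, evalPair_monomial, mul_smul]
  | add f g hf hg => rw [mul_add, evalPair_add, evalPair_add, hf, hg, smul_add]

theorem evalPair_rename_swap {P Q : B} (h : Commute P Q) (f : MvPolynomial (Fin 2) K) :
    evalPair (MvPolynomial.rename (Equiv.swap 0 1) f) Q P = evalPair f P Q := by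
  induction f using MvPolynomial.induction_on' with
  | monomial e a =>
    rw [MvPolynomial.rename_monomial, evalPair_monomial, evalPair_monomial]
    have h0 : Finsupp.mapDomain (Equiv.swap 0 1) e 0 = e (1 : Fin 2) := by simp
    have h1 : Finsupp.mapDomain (Equiv.swap 0 1) e 1 = e (0 : Fin 2) := by simp
    rw [h0, h1, (h.pow_pow _ _).eq]
  | add f g hf hg => rw [map_add, evalPair_add, evalPair_add, hf, hg]

theorem weight_fin_two (m n : ℕ) (e : Fin 2 →₀ ℕ) :
    Finsupp.weight ![m, n] e = m * e 0 + n * e 1 := by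
  simp [Finsupp.weight_apply, Finsupp.sum_fintype, mul_comm]

theorem monomial_eq_equivMvPolynomial (k l : ℕ) (c : K) :
    Bivariate.equivMvPolynomial K (monomial k (monomial l c)) =
      MvPolynomial.monomial (Finsupp.single 0 l + Finsupp.single 1 k) c := by
  rw [← C_mul_X_pow_eq_monomial, ← C_mul_X_pow_eq_monomial, MvPolynomial.monomial_eq]
  simp [Finsupp.prod_add_index', pow_add, mul_assoc]

theorem coeff_equivMvPolynomial (f : K[X][X]) (e : Fin 2 →₀ ℕ) :
    MvPolynomial.coeff e (Bivariate.equivMvPolynomial K f) = (f.coeff (e 1)).coeff (e 0) := by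
  induction f using Polynomial.induction_on' with
  | add f g hf hg => rw [map_add, MvPolynomial.coeff_add, hf, hg, coeff_add, coeff_add]
  | monomial k p =>
    induction p using Polynomial.induction_on' with
    | add p q hp hq =>
      rw [map_add, map_add, MvPolynomial.coeff_add, hp, hq, coeff_add, coeff_add]
    | monomial l c =>
      rw [monomial_eq_equivMvPolynomial, MvPolynomial.coeff_monomial, coeff_monomial]
      have he : Finsupp.single 0 l + Finsupp.single 1 k = e ↔ k = e 1 ∧ l = e 0 := by
        rw [Finsupp.ext_iff, Fin.forall_fin_two]
        simp [and_comm]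
      simp only [he]
      by_cases hk : k = e 1
      · simp [hk, coeff_monomial]
      · simp [hk]

theorem evalPair_equivMvPolynomial (f : K[X][X]) {P Q : B} (h : Commute P Q) :
    evalPair (Bivariate.equivMvPolynomial K f) P Q =
      f.sum fun k p => p.sum fun l c => c • (Q ^ k * P ^ l) := by
  have h0 : ∀ k, ((0 : K[X]).sum fun l c => c • (Q ^ k * P ^ l)) = 0 := fun k => sum_zero_index _
  have hadd : ∀ k (p q : K[X]), ((p + q).sum fun l c => c • (Q ^ k * P ^ l)) =
      (p.sum fun l c => c • (Q ^ k * P ^ l)) + q.sum fun l c => c • (Q ^ k * P ^ l) :=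
    fun k p q => sum_add_index _ _ _ (fun _ => zero_smul _ _) (fun _ _ _ => add_smul _ _ _)
  induction f using Polynomial.induction_on' with
  | add f g hf hg => rw [map_add, evalPair_add, hf, hg, sum_add_index _ _ _ h0 hadd]
  | monomial k p =>
    rw [sum_monomial_index _ _ (h0 k)]
    induction p using Polynomial.induction_on' with
    | add p q hp hq => rw [map_add, map_add, evalPair_add, hp, hq, hadd]
    | monomial l c =>
      rw [monomial_eq_equivMvPolynomial, evalPair_monomial,
        sum_monomial_index _ (fun l c => c • (Q ^ k * P ^ l)) (zero_smul _ _)]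
      simp [(h.pow_pow l k).eq]

theorem isWeightedHomogeneous_top (m n : ℕ) (c : K) :
    MvPolynomial.IsWeightedHomogeneous ![m, n]
      ((MvPolynomial.X 1 ^ (m / m.gcd n) +
        MvPolynomial.C c * MvPolynomial.X 0 ^ (n / m.gcd n)) ^ m.gcd n :
          MvPolynomial (Fin 2) K) (m * n) := by
  have h1 := (MvPolynomial.isWeightedHomogeneous_X K ![m, n] 1).pow (m / m.gcd n)
  have h2 := ((MvPolynomial.isWeightedHomogeneous_X K ![m, n] 0).pow (n / m.gcd n)).C_mul c
  have h3 : (n / m.gcd n) • ![m, n] 0 = (m / m.gcd n) • ![m, n] 1 := by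
    simp only [Matrix.cons_val_zero, Matrix.cons_val_one, smul_eq_mul]
    rw [Nat.div_mul_right_comm (Nat.gcd_dvd_right m n), Nat.div_mul_right_comm (Nat.gcd_dvd_left m n),
      mul_comm]
  rw [h3] at h2
  have h4 := (h1.add h2).pow (m.gcd n)
  have h5 : m.gcd n • (m / m.gcd n) • ![m, n] 1 = m * n := by
    simp only [Matrix.cons_val_one, smul_eq_mul]
    rw [← mul_assoc, Nat.mul_div_cancel' (Nat.gcd_dvd_left m n)]
    rfl
  rwa [h5] at h4

theorem equivMvPolynomial_top (m n : ℕ) (c : K) :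
    Bivariate.equivMvPolynomial K ((X ^ (m / m.gcd n) + C (C c * X ^ (n / m.gcd n))) ^ m.gcd n) =
      (MvPolynomial.X 1 ^ (m / m.gcd n) +
        MvPolynomial.C c * MvPolynomial.X 0 ^ (n / m.gcd n)) ^ m.gcd n := by
  simp only [map_pow, map_add, map_mul, Bivariate.equivMvPolynomial_X,
    Bivariate.equivMvPolynomial_C_C, Bivariate.equivMvPolynomial_C_X]

theorem top_ne_zero {m : ℕ} (hm : 0 < m) (n : ℕ) (c : K) :
    ((MvPolynomial.X 1 ^ (m / m.gcd n) +
      MvPolynomial.C c * MvPolynomial.X 0 ^ (n / m.gcd n)) ^ m.gcd n :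
        MvPolynomial (Fin 2) K) ≠ 0 := by
  have hm' : 0 < m / m.gcd n :=
    Nat.div_pos (Nat.gcd_le_left _ hm) (Nat.gcd_pos_of_pos_left _ hm)
  rw [← equivMvPolynomial_top]
  refine (EmbeddingLike.map_ne_zero_iff).2 (pow_ne_zero _ ?_)
  exact (monic_X_pow_add_C _ hm'.ne').ne_zero

theorem hasRelation_of_component {m n : ℕ} {P Q : B} (f : MvPolynomial (Fin 2) K) {c : K}
    (hc : c ≠ 0)
    (hdeg : ∀ e, MvPolynomial.coeff e f ≠ 0 → Finsupp.weight ![m, n] e ≤ m * n)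
    (hcomp : MvPolynomial.weightedHomogeneousComponent ![m, n] (m * n) f =
      (MvPolynomial.X 1 ^ (m / m.gcd n) +
        MvPolynomial.C c * MvPolynomial.X 0 ^ (n / m.gcd n)) ^ m.gcd n)
    (hne : MvPolynomial.weightedHomogeneousComponent ![m, n] (m * n) f ≠ 0)
    (hev : evalPair f P Q = 0) : HasRelation K m n P Q := by
  refine ⟨f, c, hc, le_antisymm ?_ ?_, hcomp, fun h => ?_, hev⟩
  · exact Finset.sup_le fun e he => hdeg e (MvPolynomial.mem_support_iff.1 he)
  · obtain ⟨e, he⟩ := MvPolynomial.ne_zero_iff.1 hne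
    rw [MvPolynomial.coeff_weightedHomogeneousComponent] at he
    split_ifs at he with h
    · rw [← h]
      exact MvPolynomial.le_weightedTotalDegree _ (MvPolynomial.mem_support_iff.2 he)
    · exact absurd rfl he
  · rw [hcomp, Nat.Coprime.gcd_eq_one h, Nat.div_one, Nat.div_one, pow_one]

/-- Exchanging the variables turns the top part into `(λ^(m/d) + c μ^(n/d))^d`; multiplication by
`c^(-d)` restores the required shape, with constant `c⁻¹`. -/
theorem HasRelation.symm {m n : ℕ} {P Q : B} (hPQ : Commute P Q) (hm : 0 < m)
    (h : HasRelation K m n P Q) : HasRelation K n m Q P := by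
  obtain ⟨f, c, hc, hdeg, hcomp, -, hev⟩ := h
  let s := Equiv.swap (0 : Fin 2) 1
  let f' := MvPolynomial.C (c⁻¹ ^ m.gcd n) * MvPolynomial.rename s f
  have hs : ∀ e : Fin 2 →₀ ℕ, ∃ e', Finsupp.mapDomain s e' = e ∧
      Finsupp.weight ![n, m] e = Finsupp.weight ![m, n] e' := fun e => by
    refine ⟨Finsupp.mapDomain s e, ?_, ?_⟩
    · rw [← Finsupp.mapDomain_comp]
      convert Finsupp.mapDomain_id
      ext i
      simp [s]
    · have h0 : Finsupp.mapDomain s e 0 = e (1 : Fin 2) := by simp [s]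
      have h1 : Finsupp.mapDomain s e 1 = e (0 : Fin 2) := by simp [s]
      rw [weight_fin_two, weight_fin_two, h0, h1, add_comm]
  have hren : MvPolynomial.weightedHomogeneousComponent ![n, m] (n * m) (MvPolynomial.rename s f) =
      MvPolynomial.rename s (MvPolynomial.weightedHomogeneousComponent ![m, n] (m * n) f) := by
    ext e
    obtain ⟨e, rfl, he⟩ := hs e
    rw [MvPolynomial.coeff_rename_mapDomain _ s.injective,
      MvPolynomial.coeff_weightedHomogeneousComponent,
      MvPolynomial.coeff_weightedHomogeneousComponent, he,
      MvPolynomial.coeff_rename_mapDomain _ s.injective, mul_comm]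
  have hcomp' : MvPolynomial.weightedHomogeneousComponent ![n, m] (n * m) f' =
      (MvPolynomial.X 1 ^ (n / n.gcd m) +
        MvPolynomial.C c⁻¹ * MvPolynomial.X 0 ^ (m / n.gcd m)) ^ n.gcd m := by
    rw [MvPolynomial.weightedHomogeneousComponent_C_mul, hren, hcomp, Nat.gcd_comm n m]
    simp only [map_pow, map_add, map_mul, MvPolynomial.rename_X, MvPolynomial.rename_C]
    rw [← mul_pow, mul_add, ← mul_assoc, ← MvPolynomial.C_mul, inv_mul_cancel₀ hc,
      MvPolynomial.C_1, one_mul, add_comm]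
    simp [s]
  refine hasRelation_of_component f' (inv_ne_zero hc) ?_ hcomp' ?_ ?_
  · intro e he
    obtain ⟨e, rfl, hw⟩ := hs e
    rw [MvPolynomial.coeff_C_mul, MvPolynomial.coeff_rename_mapDomain _ s.injective] at he
    rw [hw, mul_comm, ← hdeg]
    exact MvPolynomial.le_weightedTotalDegree _
      (MvPolynomial.mem_support_iff.2 (right_ne_zero_of_mul he))
  · rw [MvPolynomial.weightedHomogeneousComponent_C_mul, hren, hcomp]
    refine mul_ne_zero (MvPolynomial.C_ne_zero.2 (pow_ne_zero _ (inv_ne_zero hc))) ?_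
    exact (map_ne_zero_iff _ (MvPolynomial.rename_injective s s.injective)).2
      (top_ne_zero hm n c)
  · rw [evalPair_C_mul, evalPair_rename_swap hPQ, hev, smul_zero]

theorem hasRelation_of_bivariate {m n : ℕ} (hm : 0 < m) {P Q : B} (hPQ : Commute P Q)
    (f : K[X][X]) {u : K} (hu : u ≠ 0)
    (hdeg : ∀ k l, m * n < m * l + n * k → (f.coeff k).coeff l = 0)
    (htop : ∀ k l, m * l + n * k = m * n →
      (f.coeff k).coeff l = ((X ^ (m / m.gcd n) - C u) ^ m.gcd n).coeff k)
    (hev : (f.sum fun k p => p.sum fun l c => c • (Q ^ k * P ^ l)) = 0) :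
    HasRelation K m n P Q := by
  let T : K[X][X] := (X ^ (m / m.gcd n) + C (C (-u) * X ^ (n / m.gcd n))) ^ m.gcd n
  have hT : Bivariate.equivMvPolynomial K T = (MvPolynomial.X 1 ^ (m / m.gcd n) +
        MvPolynomial.C (-u) * MvPolynomial.X 0 ^ (n / m.gcd n)) ^ m.gcd n :=
    equivMvPolynomial_top m n (-u)
  have hcomp : MvPolynomial.weightedHomogeneousComponent ![m, n] (m * n)
      (Bivariate.equivMvPolynomial K f) = (MvPolynomial.X 1 ^ (m / m.gcd n) +
        MvPolynomial.C (-u) * MvPolynomial.X 0 ^ (n / m.gcd n)) ^ m.gcd n := by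
    have hhom := isWeightedHomogeneous_top m n (-u)
    ext e
    rw [MvPolynomial.coeff_weightedHomogeneousComponent]
    split_ifs with he
    · rw [weight_fin_two] at he
      rw [coeff_equivMvPolynomial, htop _ _ he, ← hT, coeff_equivMvPolynomial]
      rw [← hT] at hhom
      -- Setting `λ = 1` in `T` loses nothing: by homogeneity, and since `m > 0`, each power of `μ`
      -- occurs with a single power of `λ`.
      have h1 : (X ^ (m / m.gcd n) - C u) ^ m.gcd n = T.map (evalRingHom 1) := by
        simp [T, sub_eq_add_neg]
      rw [h1, coeff_map, coe_evalRingHom, eval_eq_sum, Polynomial.sum, Finset.sum_eq_single (e 0)]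
      · simp
      · intro l hl hl'
        exfalso
        have h2 : MvPolynomial.coeff (Finsupp.single 0 l + Finsupp.single 1 (e 1))
            (Bivariate.equivMvPolynomial K T) ≠ 0 := by
          rw [coeff_equivMvPolynomial]
          simpa using hl
        have h3 := hhom h2
        rw [weight_fin_two] at h3
        simp only [Finsupp.add_apply, Finsupp.single_apply] at h3
        refine hl' (Nat.eq_of_mul_eq_mul_left hm ?_)
        simp at h3
        omega
      · intro h
        rw [notMem_support_iff.1 h, zero_mul]
    · exact (hhom.coeff_eq_zero e he).symm
  refine hasRelation_of_component (Bivariate.equivMvPolynomial K f) (neg_ne_zero.2 hu) ?_ hcomp ?_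
    (by rw [evalPair_equivMvPolynomial f hPQ, hev])
  · intro e he
    by_contra! h
    rw [weight_fin_two] at h
    rw [coeff_equivMvPolynomial] at he
    exact he (hdeg _ _ h)
  · rw [hcomp]
    exact top_ne_zero hm n (-u)

end Relation

/-! ### The relation over an abstract differential algebra -/

/-- The Burchnall–Chaundy relation between commuting differential operators over a differential
algebra with a coordinate. -/
theorem hasRelation_of_commute {K A : Type*} [Field K] [CharZero K] [CommRing A] [Algebra K A]
    {D : Module.End K A} (hD : ∀ a b, D (a * b) = a * D b + D a * b) {z : A} (hz : D z = 1)
    (hconst : ∀ a, D a = 0 → ∃ c, algebraMap K A c = a) {m n : ℕ} (hm : 0 < m)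
    {P Q : Module.End K A} {α β : A} (hP : HasSymbol D m α P) (hQ : HasSymbol D n β Q)
    (hα : IsUnit α) (ε : A →ₐ[K] K) (hβ : ε β ≠ 0) (hPQ : Commute P Q) :
    HasRelation K m n P Q := by
  obtain ⟨α', hα'⟩ := hα.exists_right_inv
  have hsymb : ∀ i : Fin m, HasSymbol D (n + i) β (D ^ (i : ℕ) * Q) := fun i => hQ.pow_mul hD i
  choose B hB hBdeg using fun i : Fin m => exists_combo hD hP hα' hm (hsymb i).mem
  choose Γ hΓ _ using fun i : Fin m =>
    exists_combo hD hP hα' hm (mul_mem_opsLT_succ hD (pow_mem_opsLT (D := D) i.1.lt_succ_self))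
  have hinj := combo_injective hD hP hα' hz
  have hconst' := charpoly_coeff_constant hPQ hD hinj (Matrix.of B) (Matrix.of Γ) hB hΓ
  have hsum := sum_charpoly_eq_zero hm hPQ (Matrix.of B) hB
  have hε : ε α * ε α' = 1 := by rw [← map_mul, hα', map_one]
  have hε' : ε α' = (ε α)⁻¹ := eq_inv_of_mul_eq_one_right hε
  -- Evaluating `B` at a point does not change the coefficients of its characteristic polynomial,
  -- which are constants, and makes the values `ε α` and `ε β` invertible, although `β` itself may
  -- have zeros.
  let B₀ : Matrix (Fin m) (Fin m) K[X] := (mapRingHom (ε : A →+* K)).mapMatrix (Matrix.of B)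
  have hchar : ∀ k l, (B₀.charpoly.coeff k).coeff l =
      ε (((Matrix.of B).charpoly.coeff k).coeff l) := by
    intro k l
    change (((Matrix.of B).map (mapRingHom (ε : A →+* K))).charpoly.coeff k).coeff l = _
    rw [Matrix.charpoly_map, coeff_map, coe_mapRingHom, coeff_map]
    rfl
  have hcoeff : ∀ k l, algebraMap K A ((B₀.charpoly.coeff k).coeff l) =
      ((Matrix.of B).charpoly.coeff k).coeff l := by
    intro k l
    obtain ⟨c, hc⟩ := hconst _ (hconst' k l)
    rw [hchar, ← hc, AlgHom.commutes]
    rfl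
  obtain ⟨h1, h2⟩ := charpoly_weights hm n (ε α) (ε β) B₀
    (fun i j q h => by
      change ((B i j).map (ε : A →+* K)).coeff q = 0
      rw [coeff_map, hBdeg i j q (by omega), map_zero])
    (fun i j q h => by
      change ((B i j).map (ε : A →+* K)).coeff q = _
      have h3 : HasSymbol D (n + i) β ((toOpModule P).symm (combo D P m (B i))) := by
        rw [hB, LinearEquiv.symm_apply_apply]
        exact hsymb i
      rw [coeff_map, combo_coeff_eq hD hP hα' hz (fun j q hq => hBdeg i j q hq) h3 h, ← hε']
      simp)
  have hmap : B₀.charpoly.map (mapRingHom (algebraMap K A)) = (Matrix.of B).charpoly := by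
    ext k l
    rw [coeff_map, coe_mapRingHom, coeff_map, hcoeff]
  refine hasRelation_of_bivariate hm hPQ B₀.charpoly (mul_ne_zero (pow_ne_zero _ hβ)
    (pow_ne_zero _ (inv_ne_zero (left_ne_zero_of_mul_eq_one hε)))) h1 h2 ?_
  rw [← hsum, ← hmap]
  have : Nontrivial A := ε.toRingHom.domain_nontrivial
  rw [Polynomial.sum, Polynomial.sum, support_map_of_injective _
    (map_injective _ (algebraMap K A).injective)]
  refine Finset.sum_congr rfl fun k _ => ?_
  rw [coeff_map, coe_mapRingHom, Polynomial.sum, Polynomial.sum,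
    support_map_of_injective _ (algebraMap K A).injective]
  refine Finset.sum_congr rfl fun l _ => ?_
  rw [coeff_map]
  ext x
  simp [Algebra.smul_def]

end

/-! ### Smooth functions, and functions with derivative zero -/

section Functions

variable {𝕜 : Type*} [RCLike 𝕜] {I : Set 𝕜}

theorem hasDerivWithinAt_D (hI : UniqueDiffOn 𝕜 I) (f : smoothFunctions 𝕜 I) (x : I) :
    HasDerivWithinAt (Function.extend Subtype.val f.1 0) ((D 𝕜 I hI f).1 x) I x :=
  (ContDiffOn.differentiableOn f.2 (by simp) x x.2).hasDerivWithinAt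

theorem D_apply_eq (hI : UniqueDiffOn 𝕜 I) (f : smoothFunctions 𝕜 I) {g : 𝕜 → 𝕜} {g' : 𝕜} {x : I}
    (h : HasDerivWithinAt g g' I x) (hg : ∀ y : I, f.1 y = g y) : (D 𝕜 I hI f).1 x = g' := by
  refine (h.congr (fun y hy => ?_) ?_).derivWithin (hI x x.2)
  · rw [extend_apply _ hy, hg]
  · rw [extend_apply _ x.2, hg]

theorem D_mul (hI : UniqueDiffOn 𝕜 I) (f g : smoothFunctions 𝕜 I) :
    D 𝕜 I hI (f * g) = f * D 𝕜 I hI g + D 𝕜 I hI f * g := by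
  ext x
  refine (D_apply_eq hI (f * g) ((hasDerivWithinAt_D hI f x).mul (hasDerivWithinAt_D hI g x))
    fun y => ?_).trans ?_
  · simp
  · simp [add_comm]

/-- The coordinate function. -/
def coordinate (𝕜 : Type*) [RCLike 𝕜] (I : Set 𝕜) : smoothFunctions 𝕜 I :=
  ⟨fun x => x, (contDiffOn_id).congr fun x hx => by rw [extend_apply _ hx]; rfl⟩

theorem D_coordinate (hI : UniqueDiffOn 𝕜 I) : D 𝕜 I hI (coordinate 𝕜 I) = 1 := by
  ext x
  exact D_apply_eq hI _ (hasDerivWithinAt_id _ _) fun y => rfl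

/-- Evaluation at a point. -/
def evalAt (x : I) : smoothFunctions 𝕜 I →ₐ[𝕜] 𝕜 :=
  (Pi.evalAlgHom 𝕜 (fun _ : I => 𝕜) x).comp (smoothFunctions 𝕜 I).val

theorem isUnit_of_ne_zero (f : smoothFunctions 𝕜 I) (h : ∀ x, f.1 x ≠ 0) : IsUnit f := by
  have hf : ContDiffOn 𝕜 ∞ (Function.extend Subtype.val f.1 0) I := f.2
  let g : smoothFunctions 𝕜 I := ⟨fun x => (f.1 x)⁻¹,
    (hf.inv fun x hx => by rw [extend_apply _ hx]; exact h _).congr fun x hx => by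
      rw [extend_apply _ hx, Pi.inv_apply, extend_apply _ hx]⟩
  refine IsUnit.of_mul_eq_one g ?_
  ext x
  exact mul_inv_cancel₀ (h x)

theorem hasSymbol_diffOp (hI : UniqueDiffOn 𝕜 I) {m : ℕ} (α : Fin (m + 1) → smoothFunctions 𝕜 I) :
    HasSymbol (D 𝕜 I hI) m (α (Fin.last m)) (diffOp hI α) :=
  hasSymbol_sum α

theorem exists_ne_zero_of_ne_zero {f : smoothFunctions 𝕜 I} (h : f ≠ 0) : ∃ x, f.1 x ≠ 0 := by
  by_contra! h0
  exact h (Subtype.ext (funext h0))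

theorem hasRelation_diffOp_of_isUnit (hI : UniqueDiffOn 𝕜 I)
    (hconst : ∀ f, D 𝕜 I hI f = 0 → ∃ c, algebraMap 𝕜 (smoothFunctions 𝕜 I) c = f) {m n : ℕ}
    {α : Fin (m + 1) → smoothFunctions 𝕜 I} {β : Fin (n + 1) → smoothFunctions 𝕜 I}
    (hm : 0 < m) (hα : ∀ t, (α (Fin.last m)).1 t ≠ 0) (hβ : β (Fin.last n) ≠ 0)
    (h : Commute (diffOp hI α) (diffOp hI β)) :
    HasRelation 𝕜 m n (diffOp hI α) (diffOp hI β) := by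
  obtain ⟨x, hx⟩ := exists_ne_zero_of_ne_zero hβ
  exact hasRelation_of_commute (D_mul hI) (D_coordinate hI) hconst hm (hasSymbol_diffOp hI α)
    (hasSymbol_diffOp hI β) (isUnit_of_ne_zero _ hα) (evalAt x) hx h

theorem hasRelation_diffOp (hI : UniqueDiffOn 𝕜 I)
    (hconst : ∀ f, D 𝕜 I hI f = 0 → ∃ c, algebraMap 𝕜 (smoothFunctions 𝕜 I) c = f) {m n : ℕ}
    {α : Fin (m + 1) → smoothFunctions 𝕜 I} {β : Fin (n + 1) → smoothFunctions 𝕜 I}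
    (hα : α (Fin.last m) ≠ 0) (hβ : β (Fin.last n) ≠ 0)
    (hlead : 0 < m ∧ (∀ t, (α (Fin.last m)).1 t ≠ 0) ∨ 0 < n ∧ (∀ t, (β (Fin.last n)).1 t ≠ 0))
    (h : Commute (diffOp hI α) (diffOp hI β)) :
    HasRelation 𝕜 m n (diffOp hI α) (diffOp hI β) := by
  rcases hlead with ⟨hm, hα'⟩ | ⟨hn, hβ'⟩
  · exact hasRelation_diffOp_of_isUnit hI hconst hm hα' hβ h
  · exact (hasRelation_diffOp_of_isUnit hI hconst hn hβ' hα h.symm).symm h.symm hn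

theorem exists_algebraMap_eq_of_forall_eq [Nonempty I] {f : smoothFunctions 𝕜 I}
    (h : ∀ x y : I, f.1 x = f.1 y) : ∃ c, algebraMap 𝕜 (smoothFunctions 𝕜 I) c = f := by
  obtain ⟨x⟩ := ‹Nonempty I›
  exact ⟨f.1 x, by ext y; exact h x y⟩

theorem exists_algebraMap_eq_of_isOpen (hI : IsOpen I) (hc : IsConnected I)
    (f : smoothFunctions 𝕜 I) (hf : D 𝕜 I hI.uniqueDiffOn f = 0) :
    ∃ c, algebraMap 𝕜 (smoothFunctions 𝕜 I) c = f := by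
  have : Nonempty I := hc.nonempty.to_subtype
  refine exists_algebraMap_eq_of_forall_eq fun x y => ?_
  have h := hI.is_const_of_deriv_eq_zero hc.isPreconnected
    (ContDiffOn.differentiableOn f.2 (by simp)) (fun z hz => ?_) x.2 y.2
  · rwa [extend_apply _ x.2, extend_apply _ y.2] at h
  · have h1 := hasDerivWithinAt_D hI.uniqueDiffOn f ⟨z, hz⟩
    rw [hf] at h1
    exact (h1.hasDerivAt (hI.mem_nhds hz)).deriv

/-- In a chart the curve is parametrized by `γ`, and the chain rule gives `(f ∘ γ)' = 0`. Hence `f`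
is locally constant, and connectedness makes it constant. -/
theorem exists_algebraMap_eq_of_isSmoothCurve {I : Set ℂ} (hI : IsSmoothCurve I)
    [ConnectedSpace I] (f : smoothFunctions ℂ I) (hf : D ℂ I hI.uniqueDiffOn f = 0) :
    ∃ c, algebraMap ℂ (smoothFunctions ℂ I) c = f := by
  suffices h : IsLocallyConstant f.1 from
    exists_algebraMap_eq_of_forall_eq fun x y => h.apply_eq_of_preconnectedSpace x y
  rw [IsLocallyConstant.iff_eventually_eq]
  rintro ⟨z, hz⟩
  obtain ⟨Φ, hzΦ, hΦ, hΨ, hIΦ⟩ := hI z hz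
  let S : Set ℝ := {s | (s : ℂ) ∈ Φ.target}
  have hS : IsOpen S := Φ.open_target.preimage Complex.continuous_ofReal
  let γ : ℝ → ℂ := fun s => Φ.symm s
  have hγI : Set.MapsTo γ S I := fun s hs =>
    (hIΦ _ (Φ.map_target hs)).2 (by simp [Φ.right_inv hs])
  have hofReal : ContDiff ℝ ∞ (fun s : ℝ => (s : ℂ)) := Complex.ofRealCLM.contDiff
  have hγ : ContDiffOn ℝ ∞ γ S := hΨ.comp hofReal.contDiffOn fun s hs => hs
  have hre : ∀ w ∈ I ∩ Φ.source, (((Φ w).re : ℝ) : ℂ) = Φ w := fun w hw =>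
    Complex.ext (by simp) (by simp [(hIΦ w hw.2).1 hw.1])
  have hγre : ∀ w ∈ I ∩ Φ.source, γ (Φ w).re = w := fun w hw => by
    change Φ.symm (((Φ w).re : ℝ) : ℂ) = w
    rw [hre w hw, Φ.left_inv hw.2]
  have hzS : (Φ z).re ∈ S := by
    change (((Φ z).re : ℝ) : ℂ) ∈ Φ.target
    rw [hre z ⟨hz, hzΦ⟩]
    exact Φ.map_source hzΦ
  obtain ⟨r, hr, hrS⟩ := Metric.isOpen_iff.1 hS _ hzS
  let F : ℂ → ℂ := Function.extend Subtype.val f.1 0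
  have hder : ∀ s ∈ S, HasDerivAt (F ∘ γ) 0 s := fun s hs => by
    have h1 := hasDerivWithinAt_D hI.uniqueDiffOn f ⟨γ s, hγI hs⟩
    rw [hf] at h1
    have h2 : HasDerivAt γ (deriv γ s) s :=
      ((hγ.differentiableOn (by simp)).differentiableAt (hS.mem_nhds hs)).hasDerivAt
    have h3 := HasDerivWithinAt.scomp (t' := I) s h1 h2.hasDerivWithinAt hγI
    simpa using h3.hasDerivAt (hS.mem_nhds hs)
  have hconst : ∀ s ∈ Metric.ball (Φ z).re r, F (γ s) = F (γ (Φ z).re) := fun s hs =>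
    Metric.isOpen_ball.is_const_of_deriv_eq_zero (convex_ball _ _).isPreconnected
      (fun t ht => (hder t (hrS ht)).differentiableAt.differentiableWithinAt)
      (fun t ht => (hder t (hrS ht)).deriv) hs (Metric.mem_ball_self hr)
  have hcont : ContinuousAt (fun w : I => (Φ w).re) ⟨z, hz⟩ :=
    Complex.continuous_re.continuousAt.comp
      (ContinuousAt.comp (f := Subtype.val) (g := Φ) (Φ.continuousAt hzΦ)
        continuous_subtype_val.continuousAt)
  filter_upwards [hcont (Metric.ball_mem_nhds _ hr),
    continuous_subtype_val.continuousAt (Φ.open_source.mem_nhds hzΦ)] with w hw hwΦ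
  have h := hconst _ hw
  rw [hγre w ⟨w.2, hwΦ⟩, hγre z ⟨hz, hzΦ⟩] at h
  simp only [F, extend_apply _ hz, extend_apply _ w.2] at h
  exact h

end Functions

/-! ### Transfer of relations and restriction to subsets -/

theorem HasRelation.of_intertwining {K V W : Type*} [Field K] [AddCommGroup V] [Module K V]
    [AddCommGroup W] [Module K W] {ι : V →ₗ[K] W} (hι : Function.Injective ι)
    {P Q : Module.End K V} {P' Q' : Module.End K W} (hP : ∀ v, ι (P v) = P' (ι v))
    (hQ : ∀ v, ι (Q v) = Q' (ι v)) {m n : ℕ} (h : HasRelation K m n P' Q') :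
    HasRelation K m n P Q := by
  obtain ⟨f, c, hc, h1, h2, h3, h4⟩ := h
  have hpow : ∀ {R : Module.End K V} {R' : Module.End K W}, (∀ v, ι (R v) = R' (ι v)) →
      ∀ k v, ι ((R ^ k) v) = (R' ^ k) (ι v) := by
    intro R R' hR k
    induction k with
    | zero => simp
    | succ k ih =>
      intro v
      rw [pow_succ, pow_succ, Module.End.mul_apply, Module.End.mul_apply, ih, hR]
  refine ⟨f, c, hc, h1, h2, h3, LinearMap.ext fun v => hι ?_⟩
  rw [LinearMap.zero_apply, map_zero, ← LinearMap.zero_apply (σ₁₂ := RingHom.id K) (ι v), ← h4,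
    evalPair, evalPair, LinearMap.sum_apply, LinearMap.sum_apply, map_sum]
  refine Finset.sum_congr rfl fun e _ => ?_
  simp only [LinearMap.smul_apply, Module.End.mul_apply, map_smul, hpow hP, hpow hQ]

section Restriction

variable {𝕜 : Type*} [RCLike 𝕜] {I U : Set 𝕜}

/-- Restriction of functions to a subset. -/
def restrictTo (h : U ⊆ I) : smoothFunctions 𝕜 I →ₐ[𝕜] smoothFunctions 𝕜 U where
  toFun f := ⟨fun x => f.1 ⟨x, h x.2⟩,
    (ContDiffOn.mono f.2 h).congr fun x hx => by
      rw [extend_apply _ hx, extend_apply _ (h hx)]⟩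
  map_one' := rfl
  map_mul' _ _ := rfl
  map_zero' := rfl
  map_add' _ _ := rfl
  commutes' _ := rfl

theorem restrictTo_D (h : U ⊆ I) (hI : UniqueDiffOn 𝕜 I) (hU : UniqueDiffOn 𝕜 U)
    (f : smoothFunctions 𝕜 I) : restrictTo h (D 𝕜 I hI f) = D 𝕜 U hU (restrictTo h f) := by
  ext x
  exact (D_apply_eq hU _ ((hasDerivWithinAt_D hI f ⟨x, h x.2⟩).mono h)
    fun y => (extend_apply _ (h y.2)).symm).symm

theorem restrictTo_diffOp (h : U ⊆ I) (hI : UniqueDiffOn 𝕜 I) (hU : UniqueDiffOn 𝕜 U) {m : ℕ}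
    (α : Fin (m + 1) → smoothFunctions 𝕜 I) (f : smoothFunctions 𝕜 I) :
    restrictTo h (diffOp hI α f) = diffOp hU (fun i => restrictTo h (α i)) (restrictTo h f) := by
  have hpow : ∀ k, restrictTo h ((D 𝕜 I hI ^ k) f) = (D 𝕜 U hU ^ k) (restrictTo h f) := by
    intro k
    induction k with
    | zero => rfl
    | succ k ih =>
      rw [pow_succ', pow_succ', Module.End.mul_apply, Module.End.mul_apply, restrictTo_D h hI hU, ih]
  simp only [diffOp, LinearMap.sum_apply, map_sum, LinearMap.smul_apply, smul_eq_mul, map_mul, hpow]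

/-- Functions on `U` need not extend to `I`, so commutativity is not inherited pointwise. But a
differential operator is determined by its values on the powers of the coordinate, and these do
extend. -/
theorem commute_restrictTo (h : U ⊆ I) (hI : UniqueDiffOn 𝕜 I) (hU : UniqueDiffOn 𝕜 U) {m n : ℕ}
    (α : Fin (m + 1) → smoothFunctions 𝕜 I) (β : Fin (n + 1) → smoothFunctions 𝕜 I)
    (hc : Commute (diffOp hI α) (diffOp hI β)) :
    Commute (diffOp hU fun i => restrictTo h (α i)) (diffOp hU fun i => restrictTo h (β i)) := by
  have hα := hasSymbol_diffOp hU fun i => restrictTo h (α i)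
  have hβ := hasSymbol_diffOp hU fun i => restrictTo h (β i)
  have h1 := (hα.mul (D_mul hU) hβ).mem
  have h2 := (hβ.mul (D_mul hU) hα).mem
  rw [add_comm n m] at h2
  refine eq_of_apply_pow_eq (D_mul hU) (D_coordinate hU) h1 h2 fun k => ?_
  have h3 : (coordinate 𝕜 U) ^ k = restrictTo h (coordinate 𝕜 I ^ k) := by
    rw [map_pow]
    rfl
  rw [h3, Module.End.mul_apply, Module.End.mul_apply, ← restrictTo_diffOp h hI,
    ← restrictTo_diffOp h hI, ← restrictTo_diffOp h hI, ← restrictTo_diffOp h hI,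
    ← Module.End.mul_apply, ← Module.End.mul_apply, hc.eq]

end Restriction

/-! ### Holomorphic coefficients -/

section Holomorphic

variable {I : Set ℂ}

theorem eq_zero_of_eqOn_zero (hI : IsOpen I) (hc : IsConnected I) {U : Set ℂ} (hU : IsOpen U)
    (hne : U.Nonempty) (hUI : U ⊆ I) {f : smoothFunctions ℂ I}
    (h : ∀ x (hx : x ∈ U), f.1 ⟨x, hUI hx⟩ = 0) : f = 0 := by
  obtain ⟨z, hz⟩ := hne
  have hf : AnalyticOnNhd ℂ (Function.extend Subtype.val f.1 0) I :=
    (ContDiffOn.differentiableOn f.2 (by simp)).analyticOnNhd hI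
  have h0 : Function.extend Subtype.val f.1 0 =ᶠ[𝓝 z] 0 := by
    filter_upwards [hU.mem_nhds hz] with x hx
    rw [extend_apply _ (hUI hx), h x hx, Pi.zero_apply]
  have h1 := hf.eqOn_zero_of_preconnected_of_eventuallyEq_zero hc.isPreconnected (hUI hz) h0
  ext x
  have h2 := h1 x.2
  rwa [extend_apply _ x.2] at h2

/-- Continuity gives a ball on which `f` has no zeros; by the identity theorem `g` cannot vanish on
all of it. -/
theorem exists_ball_ne_zero (hI : IsOpen I) (hc : IsConnected I) {f g : smoothFunctions ℂ I}
    (hf : f ≠ 0) (hg : g ≠ 0) : ∃ z r, 0 < r ∧ ∃ h : Metric.ball z r ⊆ I,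
      (∀ x (hx : x ∈ Metric.ball z r), f.1 ⟨x, h hx⟩ ≠ 0) ∧
      ∃ x, ∃ hx : x ∈ Metric.ball z r, g.1 ⟨x, h hx⟩ ≠ 0 := by
  have hf' : ContinuousOn (Function.extend Subtype.val f.1 0) I := ContDiffOn.continuousOn f.2
  obtain ⟨x, hx⟩ := exists_ne_zero_of_ne_zero hf
  have hU : {y ∈ I | Function.extend Subtype.val f.1 0 y ≠ 0} ∈ 𝓝 (x : ℂ) := by
    have h1 : ∀ᶠ y in 𝓝 (x : ℂ), Function.extend Subtype.val f.1 0 y ≠ 0 :=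
      (hf'.continuousAt (hI.mem_nhds x.2)).eventually_ne (by rwa [extend_apply _ x.2])
    exact (hI.eventually_mem x.2).and h1
  obtain ⟨r, hr, hball⟩ := Metric.mem_nhds_iff.1 hU
  refine ⟨x, r, hr, fun y hy => (hball hy).1, fun y hy => ?_, ?_⟩
  · have h1 := (hball hy).2
    rwa [extend_apply _ (hball hy).1] at h1
  · by_contra! h0
    exact hg (eq_zero_of_eqOn_zero hI hc Metric.isOpen_ball ⟨_, Metric.mem_ball_self hr⟩
      (fun y hy => (hball hy).1) h0)

/-- The relation is obtained on a small ball and pulled back along restriction, which is injective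
by the identity theorem. -/
theorem hasRelation_diffOp_of_holomorphic (hI : IsOpen I) (hc : IsConnected I) {m n : ℕ}
    {α : Fin (m + 1) → smoothFunctions ℂ I} {β : Fin (n + 1) → smoothFunctions ℂ I} (hm : 0 < m)
    (hα : α (Fin.last m) ≠ 0) (hβ : β (Fin.last n) ≠ 0)
    (h : Commute (diffOp hI.uniqueDiffOn α) (diffOp hI.uniqueDiffOn β)) :
    HasRelation ℂ m n (diffOp hI.uniqueDiffOn α) (diffOp hI.uniqueDiffOn β) := by
  obtain ⟨z, r, hr, hU, hα', x, hx, hβ'⟩ := exists_ball_ne_zero hI hc hα hβ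
  have hUo : IsOpen (Metric.ball z r) := Metric.isOpen_ball
  have hUc : IsConnected (Metric.ball z r) :=
    ⟨⟨z, Metric.mem_ball_self hr⟩, (convex_ball _ _).isPreconnected⟩
  refine HasRelation.of_intertwining (ι := (restrictTo hU).toLinearMap) ?_
    (restrictTo_diffOp hU hI.uniqueDiffOn hUo.uniqueDiffOn α)
    (restrictTo_diffOp hU hI.uniqueDiffOn hUo.uniqueDiffOn β) ?_
  · rw [injective_iff_map_eq_zero]
    exact fun f hf => eq_zero_of_eqOn_zero hI hc hUo hUc.nonempty hU fun y hy =>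
      congrFun (congrArg Subtype.val hf) ⟨y, hy⟩
  · exact hasRelation_diffOp_of_isUnit hUo.uniqueDiffOn (exists_algebraMap_eq_of_isOpen hUo hUc) hm
      (fun t => hα' t t.2) (fun h0 => hβ' (congrFun (congrArg Subtype.val h0) ⟨x, hx⟩))
      (commute_restrictTo hU hI.uniqueDiffOn hUo.uniqueDiffOn α β h)

end Holomorphic

end BurchnallChaundy

end

theorem mainTheorem5 :
    -- Case 1: smooth real coefficients on an open interval.
    (∀ (I : Set ℝ) (hI : IsOpen I), IsConnected I →
      ∀ (m n : ℕ) (α : Fin (m + 1) → smoothFunctions ℝ I)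
        (β : Fin (n + 1) → smoothFunctions ℝ I),
        α (Fin.last m) ≠ 0 → β (Fin.last n) ≠ 0 →
        (0 < m ∧ (∀ t, (α (Fin.last m)).1 t ≠ 0) ∨ 0 < n ∧ (∀ t, (β (Fin.last n)).1 t ≠ 0)) →
        Commute (diffOp hI.uniqueDiffOn α)
          (diffOp hI.uniqueDiffOn β) →
        HasRelation ℝ m n (diffOp hI.uniqueDiffOn α)
          (diffOp hI.uniqueDiffOn β)) ∧
    -- Case 2: smooth complex coefficients on a simply connected, non-compact curve in the plane.
    (∀ (I : Set ℂ) (hI : IsSmoothCurve I), SimplyConnectedSpace I →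
      ¬ IsCompact I →
      ∀ (m n : ℕ) (α : Fin (m + 1) → smoothFunctions ℂ I)
        (β : Fin (n + 1) → smoothFunctions ℂ I),
        α (Fin.last m) ≠ 0 → β (Fin.last n) ≠ 0 →
        (0 < m ∧ (∀ t, (α (Fin.last m)).1 t ≠ 0) ∨ 0 < n ∧ (∀ t, (β (Fin.last n)).1 t ≠ 0)) →
        Commute (diffOp hI.uniqueDiffOn α)
          (diffOp hI.uniqueDiffOn β) →
        HasRelation ℂ m n (diffOp hI.uniqueDiffOn α)
          (diffOp hI.uniqueDiffOn β)) ∧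
    -- Case 3: holomorphic coefficients on a connected open subset of the complex plane.
    (∀ (I : Set ℂ) (hI : IsOpen I), IsConnected I →
      ∀ (m n : ℕ) (α : Fin (m + 1) → smoothFunctions ℂ I)
        (β : Fin (n + 1) → smoothFunctions ℂ I),
        α (Fin.last m) ≠ 0 → β (Fin.last n) ≠ 0 → (0 < m ∨ 0 < n) →
        Commute (diffOp hI.uniqueDiffOn α)
          (diffOp hI.uniqueDiffOn β) →
        HasRelation ℂ m n (diffOp hI.uniqueDiffOn α)
          (diffOp hI.uniqueDiffOn β)) := by
  refine ⟨fun I hI hc m n α β hα hβ hlead h => ?_, fun I hI hs _ m n α β hα hβ hlead h => ?_,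
    fun I hI hc m n α β hα hβ hmn h => ?_⟩
  · exact hasRelation_diffOp _ (exists_algebraMap_eq_of_isOpen hI hc) hα hβ hlead h
  · exact hasRelation_diffOp _ (exists_algebraMap_eq_of_isSmoothCurve hI) hα hβ hlead h
  · rcases hmn with hm | hn
    · exact hasRelation_diffOp_of_holomorphic hI hc hm hα hβ h
    · exact (hasRelation_diffOp_of_holomorphic hI hc hn hβ hα h.symm).symm h.symm hn
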